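/- For a finite group $X$ let $\mathrm m(X)$ be the number of maximal subgroups of $X$, let $\Phi(X)$ be its Frattini subgroup and, if $X$ is not cyclic, let $\sigma(X)$ be the least positive integer $n$ such that $X$ is the union of $n$ proper subgroups. Write $\mathbb Z_n$ for the cyclic group of order $n$. **Corollary 3.4.** Let $G$ be a finite non-nilpotent soluble group, put $\sigma=\sigma(G)$, and suppose that $\mathrm m(G)<2\sigma-1$. Then $\sigma\neq 3$, the number $\sigma-1$ is a power of a prime with positive exponent, and, writing $E_{\sigma-1}$ for the elementary abelian group of order $\sigma-1$, there exist a positive integer $t$ dividing $|\mathrm{Aut}(E_{\sigma-1})|$, a semidirect product $E_{\sigma-1}\rtimes\mathbb Z_t$ (for some action of $\mathbb Z_t$ on $E_{\sigma-1}$ by automorphisms), an integer $\ell\ge 0$ and distinct primes $p_1,\dots,p_\ell$ coprime to $t$ such that $$\ell=\mathrm m(G)-\mathrm m(\mathbb Z_t)-\sigma+1$$ and $$G/\Phi(G)\;\cong\;(E_{\sigma-1}\rtimes\mathbb Z_t)\times\mathbb Z_{p_1\cdots p_\ell},$$ where the empty product (for $\ell=0$) is $1$. -/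

import Mathlib

/-- `m(G)`: the number of maximal subgroups of `G`. -/
noncomputable def numMaximalSubgroups (G : Type*) [Group G] : ℕ :=
  Nat.card {M : Subgroup G // IsCoatom M}

/-- `G` is the union of (at most) `n` proper subgroups `H 0, …, H (n - 1)`. -/
def IsUnionOfProperSubgroups (G : Type*) [Group G] (n : ℕ) : Prop :=
  ∃ H : Fin n → Subgroup G, (∀ i, H i ≠ ⊤) ∧ (⋃ i, (H i : Set G)) = Set.univ

/-- `σ(G)`: the least `n` such that `G` is the union of `n` proper subgroups.
For a finite group such an `n` exists exactly when `G` is not cyclic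
(for a cyclic group the value is the default `0`). -/
noncomputable def coveringNumber (G : Type*) [Group G] : ℕ :=
  sInf {n : ℕ | IsUnionOfProperSubgroups G n}

/-- The value of `coveringNumber` is attained for every finite non-cyclic group. -/
theorem coveringNumber_isLeast (G : Type*) [Group G] [Finite G] (hG : ¬ IsCyclic G) :
    IsLeast {n : ℕ | IsUnionOfProperSubgroups G n} (coveringNumber G) := by
  have hne : {n : ℕ | IsUnionOfProperSubgroups G n}.Nonempty := by
    refine ⟨Nat.card G, fun i => Subgroup.zpowers ((Finite.equivFin G).symm i), ?_, ?_⟩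
    · intro i h
      exact hG ⟨(Finite.equivFin G).symm i, fun x => (Subgroup.eq_top_iff' _).mp h x⟩
    · ext g
      simp only [Set.mem_iUnion, SetLike.mem_coe, Set.mem_univ, iff_true]
      exact ⟨Finite.equivFin G g, by simp⟩
  exact ⟨Nat.sInf_mem hne, fun _ h => Nat.sInf_le h⟩

/-- The cyclic group `ℤ_n` of order `n` (for `n ≠ 0`), written multiplicatively. -/
abbrev CyclicGroupZ (n : ℕ) : Type := Multiplicative (ZMod n)

/-- The elementary abelian group of order `q ^ k` (`q` a prime), written multiplicatively. -/
abbrev ElementaryAbelian (q k : ℕ) : Type := Multiplicative (Fin k → ZMod q)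

/-!
The main inequality is `σ(G) ≤ |G : L| + 1` for every non-normal maximal subgroup `L` of a finite
soluble group `G`. Choose `L` of least index and pass to the primitive quotient `Q = B ⋊ L` by the
core of `L`, with `B` the unique minimal normal subgroup. If `Q / B` is cyclic, then `B` and the
`|B|` conjugates of `L` cover `Q`. If `Q / B` is nilpotent but not cyclic, then it has a non-cyclic
Sylow `p`-subgroup for some `p`, so that `p + 1` proper subgroups cover it, and `p < |B|` because
it acts faithfully on `B`. If `Q / B` is not nilpotent, then some non-normal maximal subgroup `M`
of it does not contain some normal `p`-subgroup `P`. For `P` minimal, the faithful irreducible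
action on `B` yields a normal subgroup `Y < P` with `|P : Y| ≤ |B|`, and `M`, which contains `Y`,
has index less than `|B|`, against the choice of `L`.

When `m(G) < 2σ(G) - 1`, counting maximal subgroups then forces `G / G'` to be cyclic and the
non-normal maximal subgroups to form a single conjugacy class. Modulo the Frattini subgroup, `G'`
is minimal normal with a cyclic complement `L`; the core of `L` is central, of squarefree order
and with a complement `T` in `L` of coprime order, so that `G = (G' ⋊ T) × core L`. Here
`σ(G) = |G'| + 1`, and `m(G)` is `|G'|` plus the number of primes dividing `|L|`. Finally
`σ(G) = 3` would make `L` a subgroup of index `2`, hence normal.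
-/

open scoped commutatorElement

theorem inv_mul_mem_center {G : Type*} [Group G] {x y : G} (h : ∀ g : G, ⁅g, x⁆ = ⁅g, y⁆) :
    x⁻¹ * y ∈ Subgroup.center G := by
  refine Subgroup.mem_center_iff.mpr fun g => ?_
  have hconj : x * g * x⁻¹ = y * g * y⁻¹ := by simpa [commutatorElement_def, mul_assoc] using h g⁻¹
  calc g * (x⁻¹ * y) = x⁻¹ * (x * g * x⁻¹) * y := by group
    _ = x⁻¹ * y * g := by rw [hconj]; group

section SemisimpleModules

variable {R M P : Type*} [Ring R] [AddCommGroup M] [Module R M] [Group P]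

theorem card_mul_card_le_of_disjoint [Finite M] {S T W : Submodule R M} (hST : Disjoint S T)
    (hS : S ≤ W) (hT : T ≤ W) : Nat.card S * Nat.card T ≤ Nat.card W := by
  rw [← Nat.card_prod]
  refine Nat.card_le_card_of_injective
    (fun x : S × T => (⟨x.1 + x.2, W.add_mem (hS x.1.2) (hT x.2.2)⟩ : W)) fun x y hxy => ?_
  have hST' : Disjoint S.toAddSubgroup T.toAddSubgroup :=
    AddSubgroup.disjoint_iff_add_eq_zero.mpr (Submodule.disjoint_iff_add_eq_zero.mp hST)
  exact AddSubgroup.add_injective_of_disjoint hST' (congrArg Subtype.val hxy)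

theorem exists_isSimpleModule_disjoint_sup_eq [IsSemisimpleModule R M] {W : Submodule R M}
    (hW : W ≠ ⊥) :
    ∃ S T : Submodule R M, IsSimpleModule R S ∧ T < W ∧ Disjoint S T ∧ S ⊔ T = W := by
  obtain ⟨S, hS, hSW⟩ := (eq_bot_or_exists_atom_le W).resolve_left hW
  obtain ⟨T, hT⟩ := exists_isCompl S
  have hdisj : Disjoint S (W ⊓ T) := hT.disjoint.mono_right inf_le_right
  refine ⟨S, W ⊓ T, isSimpleModule_iff_isAtom.mpr hS, inf_le_left.lt_of_ne fun h => hS.1 ?_,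
    hdisj, ?_⟩
  · exact hdisj.eq_bot_of_le (hSW.trans h.ge)
  · rw [inf_comm, ← sup_inf_assoc_of_le T hSW, hT.sup_eq_top, top_inf_eq]

theorem index_le_card_of_forall_isSimpleModule [IsSemisimpleModule R M] [Finite M] [Finite P]
    (C : Submodule R M → Subgroup P) (hsup : ∀ W₁ W₂, C W₁ ⊓ C W₂ ≤ C (W₁ ⊔ W₂)) (hbot : C ⊥ = ⊤)
    (hsimple : ∀ W : Submodule R M, IsSimpleModule R W → (C W).index ≤ Nat.card W)
    (W : Submodule R M) : (C W).index ≤ Nat.card W := by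
  induction W using WellFoundedLT.induction with
  | ind W ih =>
    rcases eq_or_ne W ⊥ with rfl | hW
    · simp [hbot]
    · obtain ⟨S, T, hS, hTW, hST, rfl⟩ := exists_isSimpleModule_disjoint_sup_eq hW
      calc (C (S ⊔ T)).index ≤ (C S ⊓ C T).index :=
            Nat.le_of_dvd Nat.card_pos (Subgroup.index_dvd_of_le (hsup S T))
        _ ≤ (C S).index * (C T).index := Subgroup.index_inf_le
        _ ≤ Nat.card S * Nat.card T := Nat.mul_le_mul (hsimple S hS) (ih T hTW)
        _ ≤ Nat.card (S ⊔ T : Submodule R M) :=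
            card_mul_card_le_of_disjoint hST le_sup_left le_sup_right

variable (f : P →* R)

/-- The kernel of the action of `P` on the `R`-module `M` through a homomorphism `f : P →* R`. In
this section `R` plays the role of the group ring of `P`. -/
def actionKernel (M : Type*) [AddCommGroup M] [Module R M] : Subgroup P :=
  ((Module.toAddMonoidEnd R M).toMonoidHom.comp f).ker

instance actionKernel_normal (M : Type*) [AddCommGroup M] [Module R M] :
    (actionKernel f M).Normal :=
  MonoidHom.normal_ker _

/-- The elements of `P` which act on the `R`-module `M`, through `f : P →* R`, as central elements
of the group of automorphisms induced by `P`. -/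
def actionCenter (M : Type*) [AddCommGroup M] [Module R M] : Subgroup P :=
  (Subgroup.center (P ⧸ actionKernel f M)).comap (QuotientGroup.mk' _)

variable {f}

theorem mem_actionKernel {x : P} : x ∈ actionKernel f M ↔ ∀ m : M, f x • m = m := by
  rw [actionKernel, MonoidHom.mem_ker]
  exact DFunLike.ext_iff

theorem mem_actionCenter {x : P} :
    x ∈ actionCenter f M ↔ ∀ g, ⁅x, g⁆ ∈ actionKernel f M := by
  rw [actionCenter, Subgroup.mem_comap, Subgroup.mem_center_iff]
  refine QuotientGroup.mk_surjective.forall.trans (forall_congr' fun g => ?_)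
  rw [QuotientGroup.mk'_apply, eq_comm, ← commutatorElement_eq_one_iff_mul_comm]
  exact QuotientGroup.eq_one_iff ⁅x, g⁆

theorem actionKernel_inf_le (W₁ W₂ : Submodule R M) :
    actionKernel f W₁ ⊓ actionKernel f W₂ ≤ actionKernel f (W₁ ⊔ W₂ : Submodule R M) := by
  rintro x ⟨hx₁, hx₂⟩
  replace hx₁ := mem_actionKernel.mp hx₁
  replace hx₂ := mem_actionKernel.mp hx₂
  refine mem_actionKernel.mpr fun ⟨w, hw⟩ => Subtype.ext ?_
  obtain ⟨a, ha, b, hb, rfl⟩ := Submodule.mem_sup.mp hw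
  exact (smul_add _ a b).trans
    (congrArg₂ (· + ·) (congrArg Subtype.val (hx₁ ⟨a, ha⟩)) (congrArg Subtype.val (hx₂ ⟨b, hb⟩)))

theorem actionCenter_inf_le (W₁ W₂ : Submodule R M) :
    actionCenter f W₁ ⊓ actionCenter f W₂ ≤ actionCenter f (W₁ ⊔ W₂ : Submodule R M) :=
  fun _ hx => mem_actionCenter.mpr fun g => actionKernel_inf_le W₁ W₂
    ⟨mem_actionCenter.mp hx.1 g, mem_actionCenter.mp hx.2 g⟩

theorem actionKernel_eq_top [Subsingleton M] : actionKernel f M = ⊤ :=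
  eq_top_iff.mpr fun _ _ => mem_actionKernel.mpr fun _ => Subsingleton.elim _ _

theorem actionCenter_eq_top [Subsingleton M] : actionCenter f M = ⊤ :=
  eq_top_iff.mpr fun _ _ => mem_actionCenter.mpr fun _ => by
    rw [actionKernel_eq_top]; exact Subgroup.mem_top _

theorem actionKernel_top : actionKernel f (⊤ : Submodule R M) = actionKernel f M := by
  ext x
  simp only [mem_actionKernel, Subtype.ext_iff, Subtype.forall, Submodule.mem_top, forall_true_left,
    Submodule.coe_smul]

theorem actionCenter_top : actionCenter f (⊤ : Submodule R M) = actionCenter f M := by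
  ext x
  simp only [mem_actionCenter, actionKernel_top]

theorem mem_actionKernel_of_smul_eq [IsSimpleModule R M] {x : P} (hx : f x ∈ Set.center R) {m : M}
    (hm : m ≠ 0) (hxm : f x • m = m) : x ∈ actionKernel f M := by
  refine mem_actionKernel.mpr fun u => ?_
  obtain ⟨r, rfl⟩ := IsSimpleModule.toSpanSingleton_surjective R hm u
  rw [LinearMap.toSpanSingleton_apply, smul_smul, (hx.comm r).eq, mul_smul, hxm]

theorem index_actionKernel_le_card_of_isSimpleModule [IsSimpleModule R M] [Finite M]
    (hf : ∀ x, f x ∈ Set.center R) : (actionKernel f M).index ≤ Nat.card M := by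
  have := IsSimpleModule.nontrivial R M
  obtain ⟨m, hm⟩ := exists_ne (0 : M)
  refine Nat.card_le_card_of_injective (fun q : P ⧸ actionKernel f M => f q.out • m)
    fun a b hab => ?_
  rw [← a.out_eq, ← b.out_eq]
  refine QuotientGroup.eq.mpr (mem_actionKernel_of_smul_eq (hf _) hm ?_)
  rw [map_mul, mul_smul, ← show f a.out • m = f b.out • m from hab, smul_smul, ← map_mul,
    inv_mul_cancel, map_one, one_smul]

theorem index_actionKernel_le_card [IsSemisimpleModule R M] [Finite M] [Finite P]
    (hf : ∀ x, f x ∈ Set.center R) : (actionKernel f M).index ≤ Nat.card M := by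
  rw [← actionKernel_top, ← Nat.card_congr (Submodule.topEquiv (R := R) (M := M)).toEquiv]
  exact index_le_card_of_forall_isSimpleModule (fun W => actionKernel f W) actionKernel_inf_le
    actionKernel_eq_top (fun W _ => index_actionKernel_le_card_of_isSimpleModule hf) ⊤

theorem linearIndependent_of_forall_apply_eq_smul {K V ι Γ : Type*} [Field K] [AddCommGroup V]
    [Module K V] (T : Γ → Module.End K V) {v : ι → V} (hv : ∀ i, v i ≠ 0) {c : ι → Γ → K}
    (hc : Function.Injective c) (hT : ∀ i g, T g (v i) = c i g • v i) :
    LinearIndependent K v := by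
  classical
  refine linearIndependent_iff'.mpr fun s => ?_
  induction s using Finset.induction_on with
  | empty => simp
  | insert j s hj ih =>
    intro a ha
    rw [Finset.sum_insert hj] at ha
    have hs : ∀ i ∈ s, a i = 0 := by
      intro i hi
      obtain ⟨g, hg⟩ := Function.ne_iff.mp fun h : c i = c j => hj (hc h ▸ hi)
      -- applying `T g - c j g` to the relation removes its `j`-th term
      have hrel : ∑ i ∈ s, (a i * (c i g - c j g)) • v i = 0 := by
        have := congrArg (T g - algebraMap K (Module.End K V) (c j g)) ha
        simpa only [map_add, map_sum, map_smul, map_zero, LinearMap.sub_apply, hT,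
          Module.algebraMap_end_apply, sub_self, smul_zero, zero_add, ← sub_smul, smul_smul]
          using this
      exact (mul_eq_zero.mp (ih _ hrel i hi)).resolve_right (sub_ne_zero.mpr hg)
    rw [Finset.sum_eq_zero fun i hi => by rw [hs i hi, zero_smul], add_zero] at ha
    exact (Finset.forall_mem_insert _ _ _).mpr ⟨(smul_eq_zero.mp ha).resolve_right (hv j), hs⟩

theorem sq_le_three_pow (n : ℕ) : n * n ≤ 3 ^ n := by
  induction n with
  | zero => simp
  | succ n ih =>
    rcases Nat.lt_or_ge n 2 with h | h
    · interval_cases n <;> norm_num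
    · rw [pow_succ]; nlinarith

theorem card_le_card_of_commute_up_to_smul {D V Γ ι : Type*} [Field D] [AddCommGroup V]
    [Module D V] [Finite V] [Nontrivial V] (hD : 3 ≤ Nat.card D) (ρ : Γ → (Module.End D V)ˣ)
    {x : ι → Module.End D V} (hx : ∀ i, x i ≠ 0) {c : ι → Γ → D} (hc : Function.Injective c)
    (h : ∀ i g, ρ g * x i = c i g • (x i * ρ g)) : Nat.card ι ≤ Nat.card V := by
  have : FiniteDimensional D V := Module.Finite.of_finite
  have hli : LinearIndependent D x := by
    refine linearIndependent_of_forall_apply_eq_smul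
      (fun g => LinearMap.mulRight D (↑(ρ g)⁻¹ : Module.End D V) *
        LinearMap.mulLeft D (ρ g : Module.End D V)) hx hc fun i g => ?_
    simp [h]
  calc Nat.card ι ≤ Module.finrank D V * Module.finrank D V := by
        have := hli.finite
        have := Fintype.ofFinite ι
        rw [Nat.card_eq_fintype_card, ← Module.finrank_linearMap D D]
        exact hli.fintype_card_le_finrank
    _ ≤ 3 ^ Module.finrank D V := sq_le_three_pow _
    _ ≤ Nat.card D ^ Module.finrank D V := Nat.pow_le_pow_left hD _
    _ = Nat.card V := (Module.natCard_eq_pow_finrank (K := D)).symm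

/-- Scalar multiplication by a central element of `R`, as an element of the division ring
`Module.End R M`. -/
def centralScalar (M : Type*) [AddCommGroup M] [Module R M] {r : R} (hr : r ∈ Set.center R) :
    Module.End R M where
  toFun m := r • m
  map_add' := smul_add r
  map_smul' s m := by rw [RingHom.id_apply, smul_smul, smul_smul, (hr.comm s).eq]

/-- The action of `P` on `M` through `f`, as automorphisms linear over `Module.End R M`. -/
def actionUnits (f : P →* R) (M : Type*) [AddCommGroup M] [Module R M] :
    P →* (Module.End (Module.End R M) M)ˣ :=
  ((Module.toModuleEnd (Module.End R M) (S := R) M).toMonoidHom.comp f).toHomUnits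

theorem three_le_card_end [Finite (Module.End R M)] [Nontrivial M]
    (hf : ∀ x y : P, f ⁅x, y⁆ ∈ Set.center R) (h : actionCenter f M ≠ ⊤) :
    3 ≤ Nat.card (Module.End R M) := by
  obtain ⟨x, -, hx⟩ := SetLike.exists_of_lt h.lt_top
  rw [mem_actionCenter] at hx
  push Not at hx
  obtain ⟨g, hg⟩ := hx
  have := Fintype.ofFinite (Module.End R M)
  rw [Nat.card_eq_fintype_card]
  refine Fintype.two_lt_card_iff.mpr
    ⟨0, 1, centralScalar M (hf x g), zero_ne_one, fun h0 => ?_, fun h1 => ?_⟩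
  · obtain ⟨m, hm⟩ := exists_ne (0 : M)
    refine hm (((Group.isUnit ⁅x, g⁆).map f).smul_eq_zero.mp ?_)
    exact (DFunLike.congr_fun h0 m).symm
  · exact hg (mem_actionKernel.mpr fun m => (DFunLike.congr_fun h1 m).symm)

theorem inv_mul_mem_actionCenter {x y : P}
    (h : ∀ g : P, ∀ m : M, f ⁅g, x⁆ • m = f ⁅g, y⁆ • m) : x⁻¹ * y ∈ actionCenter f M := by
  have hmk : ∀ g : P, ((⁅g, x⁆ : P) : P ⧸ actionKernel f M) = (⁅g, y⁆ : P) := fun g => by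
    refine QuotientGroup.eq.mpr (mem_actionKernel.mpr fun m => ?_)
    rw [map_mul, mul_smul, ← h, smul_smul, ← map_mul, inv_mul_cancel, map_one, one_smul]
  exact inv_mul_mem_center (x := (x : P ⧸ actionKernel f M)) (y := y)
    (QuotientGroup.mk_surjective.forall.mpr hmk)

theorem index_actionCenter_le_card_of_isSimpleModule [IsSimpleModule R M] [Finite M]
    (hf : ∀ x y : P, f ⁅x, y⁆ ∈ Set.center R) : (actionCenter f M).index ≤ Nat.card M := by
  rcases eq_or_ne (actionCenter f M) ⊤ with htop | htop
  · rw [htop, Subgroup.index_top]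
    exact Nat.card_pos
  have := IsSimpleModule.nontrivial R M
  have : Finite (Module.End R M) := DFunLike.finite _
  classical
  let _ : DivisionRing (Module.End R M) := Module.End.instDivisionRing
  let _ : Field (Module.End R M) := littleWedderburn _
  let _ : Module (Module.End R M) M := Module.End.applyModule
  refine card_le_card_of_commute_up_to_smul (three_le_card_end hf htop) (actionUnits f M)
    (x := fun q : P ⧸ actionCenter f M => (actionUnits f M q.out : Module.End (Module.End R M) M))
    (fun q => Units.ne_zero (M₀ := Module.End (Module.End R M) M) _)
    (c := fun q g => centralScalar M (hf g q.out)) (fun a b hab => ?_) fun q g => ?_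
  · rw [← a.out_eq, ← b.out_eq]
    refine QuotientGroup.eq.mpr (inv_mul_mem_actionCenter fun g m => ?_)
    exact DFunLike.congr_fun (congrFun hab g) m
  · ext m
    change f g • f q.out • m = f ⁅g, q.out⁆ • f q.out • f g • m
    simp only [smul_smul, ← map_mul]
    rw [show ⁅g, q.out⁆ * (q.out * g) = g * q.out by group]

theorem index_actionCenter_le_card [IsSemisimpleModule R M] [Finite M] [Finite P]
    (hf : ∀ x y : P, f ⁅x, y⁆ ∈ Set.center R) : (actionCenter f M).index ≤ Nat.card M := by
  rw [← actionCenter_top, ← Nat.card_congr (Submodule.topEquiv (R := R) (M := M)).toEquiv]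
  exact index_le_card_of_forall_isSimpleModule (fun W => actionCenter f W) actionCenter_inf_le
    actionCenter_eq_top (fun W _ => index_actionCenter_le_card_of_isSimpleModule hf) ⊤

end SemisimpleModules

section Weights

open Module.End

variable {K J V : Type*} [Field K] [Group J] [AddCommGroup V] [Module K V]
  (ρ : J →* Module.End K V) (A : Subgroup J)

/-- The weight space of the subgroup `A` for the system of eigenvalues `χ`; here `χ` is an arbitrary
function, and it is called a weight when its weight space is nonzero. -/
def weightSpace (χ : A → K) : Submodule K V :=
  ⨅ a : A, (ρ a).eigenspace (χ a)

variable {ρ A}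

theorem mem_weightSpace {χ : A → K} {v : V} : v ∈ weightSpace ρ A χ ↔ ∀ a : A, ρ a v = χ a • v := by
  simp only [weightSpace, Submodule.mem_iInf, mem_eigenspace_iff]

theorem commute_apply_of_isMulCommutative [IsMulCommutative A] (a b : A) :
    Commute (ρ a) (ρ b) := by
  rw [Commute, SemiconjBy, ← map_mul, ← map_mul, ← Subgroup.coe_mul, mul_comm', Subgroup.coe_mul]

theorem iSupIndep_weightSpace [IsMulCommutative A] : iSupIndep (weightSpace ρ A) :=
  (independent_iInf_maxGenEigenspace_of_forall_mapsTo (fun a : A => ρ a) fun a b φ =>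
    mapsTo_maxGenEigenspace_of_comm (commute_apply_of_isMulCommutative b a) φ).mono
    fun _ => iInf_mono fun _ => eigenspace_le_maxGenEigenspace

theorem isFinitelySemisimple_apply (hK : (Nat.card A : K) ≠ 0) (a : A) :
    (ρ a).IsFinitelySemisimple := by
  refine IsSemisimple.isFinitelySemisimple (isSemisimple_of_squarefree_aeval_eq_zero
    (p := Polynomial.X ^ Nat.card A - 1)
    (Polynomial.X_pow_sub_one_separable_iff.mpr hK).squarefree ?_)
  rw [map_sub, map_pow, Polynomial.aeval_X, map_one, ← map_pow, ← Subgroup.coe_pow,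
    pow_card_eq_one', Subgroup.coe_one, map_one, sub_self]

theorem iSup_weightSpace_eq_top [IsAlgClosed K] [FiniteDimensional K V] [IsMulCommutative A]
    (hK : (Nat.card A : K) ≠ 0) : ⨆ χ, weightSpace ρ A χ = ⊤ := by
  simp only [weightSpace, ← (isFinitelySemisimple_apply hK _).maxGenEigenspace_eq_eigenspace]
  exact iSup_iInf_maxGenEigenspace_eq_top_of_iSup_maxGenEigenspace_eq_top_of_commute
    (fun a : A => ρ a) (fun a b _ => commute_apply_of_isMulCommutative a b)
    fun _ => iSup_maxGenEigenspace_eq_top _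

variable [A.Normal]

theorem apply_mem_weightSpace {χ : A → K} {v : V} (x : J) (hv : v ∈ weightSpace ρ A χ) :
    ρ x v ∈ weightSpace ρ A fun a => χ (MulAut.conjNormal x⁻¹ a) := by
  refine mem_weightSpace.mpr fun a => ?_
  rw [← map_smul, ← mem_weightSpace.mp hv, ← mul_apply, ← mul_apply, ← map_mul, ← map_mul,
    MulAut.conjNormal_apply]
  congr 2
  group

theorem weightSpace_conj_ne_bot {χ : A → K} (x : J) (hχ : weightSpace ρ A χ ≠ ⊥) :
    weightSpace ρ A (fun a => χ (MulAut.conjNormal x⁻¹ a)) ≠ ⊥ := by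
  obtain ⟨v, hv, hv0⟩ := Submodule.exists_mem_ne_zero_of_ne_bot hχ
  refine (Submodule.ne_bot_iff _).mpr ⟨ρ x v, apply_mem_weightSpace x hv, fun h => hv0 ?_⟩
  rw [← Module.End.one_apply (R := K) v, ← map_one ρ, ← inv_mul_cancel x, map_mul, mul_apply, h,
    map_zero]

variable (ρ A)

/-- The conjugation action of `J` on the weights of its normal subgroup `A`. -/
def weightPerm : J →* Equiv.Perm {χ : A → K // weightSpace ρ A χ ≠ ⊥} :=
  MonoidHom.toHomPerm
    { toFun x χ := ⟨fun a => χ.1 (MulAut.conjNormal x⁻¹ a), weightSpace_conj_ne_bot x χ.2⟩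
      map_one' := funext fun χ => Subtype.ext <| funext fun a => by simp [Function.End.one_def]
      map_mul' x y := funext fun χ => Subtype.ext <| funext fun a => by
        simp only [mul_inv_rev, map_mul]
        rfl }

variable {ρ A}

theorem ker_weightPerm_le_centralizer [IsAlgClosed K] [FiniteDimensional K V] [IsMulCommutative A]
    (hρ : Function.Injective ρ) (hK : (Nat.card A : K) ≠ 0) :
    (weightPerm ρ A).ker ≤ Subgroup.centralizer (A : Set J) := by
  intro x hx
  have hfix : ∀ χ, weightSpace ρ A χ ≠ ⊥ → ∀ a, χ (MulAut.conjNormal x⁻¹ a) = χ a := fun χ hχ a =>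
    congrArg (fun π : Equiv.Perm {χ // weightSpace ρ A χ ≠ ⊥} => (π ⟨χ, hχ⟩).1 a) hx
  have heq : ∀ a : A, ρ (MulAut.conjNormal x⁻¹ a) = ρ a := by
    intro a
    ext v
    have hv : v ∈ ⨆ χ, weightSpace ρ A χ := iSup_weightSpace_eq_top (ρ := ρ) hK ▸ trivial
    induction hv using Submodule.iSup_induction' with
    | mem χ v hv =>
      rcases eq_or_ne (weightSpace ρ A χ) ⊥ with hχ | hχ
      · rw [hχ, Submodule.mem_bot] at hv
        rw [hv, map_zero, map_zero]
      · rw [mem_weightSpace.mp hv, mem_weightSpace.mp hv, hfix χ hχ]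
    | zero => rw [map_zero, map_zero]
    | add u v _ _ hu hv => rw [map_add, map_add, hu, hv]
  refine Subgroup.mem_centralizer_iff.mpr fun a ha => ?_
  have hconj := hρ (heq ⟨a, ha⟩)
  rw [MulAut.conjNormal_apply, inv_inv] at hconj
  calc a * x = x * (x⁻¹ * a * x) := by group
    _ = x * a := by rw [hconj]

theorem exists_perm_hom_of_isAlgClosed [IsAlgClosed K] [FiniteDimensional K V] [IsMulCommutative A]
    (hρ : Function.Injective ρ) (hK : (Nat.card A : K) ≠ 0) :
    ∃ n ≤ Module.finrank K V,
      ∃ f : J →* Equiv.Perm (Fin n), f.ker ≤ Subgroup.centralizer (A : Set J) := by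
  classical
  let _ := (iSupIndep_weightSpace (ρ := ρ) (A := A)).fintypeNeBotOfFiniteDimensional
  let e := Fintype.equivFin {χ // weightSpace ρ A χ ≠ ⊥}
  refine ⟨_, iSupIndep_weightSpace.subtype_ne_bot_le_finrank,
    e.permCongrHom.toMonoidHom.comp (weightPerm ρ A), ?_⟩
  rw [MulEquiv.toMonoidHom_eq_coe, MonoidHom.ker_mulEquiv_comp]
  exact ker_weightPerm_le_centralizer hρ hK

theorem exists_perm_hom [FiniteDimensional K V] [IsMulCommutative A]
    (hρ : Function.Injective ρ) (hK : (Nat.card A : K) ≠ 0) :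
    ∃ n ≤ Module.finrank K V,
      ∃ f : J →* Equiv.Perm (Fin n), f.ker ≤ Subgroup.centralizer (A : Set J) := by
  rw [← Module.finrank_baseChange (R := AlgebraicClosure K)]
  refine exists_perm_hom_of_isAlgClosed
    (ρ := (Module.End.baseChangeHom K (AlgebraicClosure K) V).toRingHom.toMonoidHom.comp ρ)
    ((LinearMap.baseChangeHom_injective K V (AlgebraicClosure K)).comp hρ) ?_
  rw [← map_natCast (algebraMap K (AlgebraicClosure K))]
  exact (map_ne_zero _).mpr hK

end Weights

theorem card_le_two_pow_of_isPGroup_perm {p : ℕ} [hp : Fact p.Prime] {α : Type*} [Finite α]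
    {H : Subgroup (Equiv.Perm α)} (hH : IsPGroup p H) : Nat.card H ≤ 2 ^ Nat.card α := by
  obtain ⟨n, hn⟩ := IsPGroup.iff_card.mp hH
  have hdvd : p ^ n ∣ (Nat.card α).factorial := by
    rw [← hn, ← Nat.card_perm]
    exact H.card_subgroup_dvd_card
  have hle : (p - 1) * n ≤ Nat.card α :=
    calc (p - 1) * n ≤ (p - 1) * padicValNat p (Nat.card α).factorial :=
          Nat.mul_le_mul_left _ ((padicValNat_dvd_iff_le (Nat.factorial_ne_zero _)).mp hdvd)
      _ ≤ Nat.card α := sub_one_mul_padicValNat_factorial (p := p) _ ▸ Nat.sub_le _ _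
  have hp_le : p ≤ 2 ^ (p - 1) := Nat.le_of_pred_lt Nat.lt_two_pow_self
  calc Nat.card H = p ^ n := hn
    _ ≤ (2 ^ (p - 1)) ^ n := Nat.pow_le_pow_left hp_le n
    _ = 2 ^ ((p - 1) * n) := (pow_mul _ _ _).symm
    _ ≤ 2 ^ Nat.card α := Nat.pow_le_pow_right two_pos hle

section PGroupsInCoprimeCharacteristic

theorem commutator_commutator_eq_bot_of_forall_abelian {J : Type*} [Group J] (P : Subgroup J)
    [P.Normal] [Group.IsNilpotent P]
    (h : ∀ A : Subgroup J, A ≤ P → A.Normal → ⁅A, A⁆ = ⊥ → ⁅A, P⁆ = ⊥) : ⁅⁅P, P⁆, P⁆ = ⊥ := by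
  obtain ⟨n, hn⟩ := (Subgroup.isNilpotent_iff_lowerCentralSeries P).mp ‹_›
  have hnormal : ∀ m, (P.lowerCentralSeries m).Normal := by
    intro m
    induction m with
    | zero => rwa [Subgroup.lowerCentralSeries_zero]
    | succ m _ => rw [Subgroup.lowerCentralSeries_succ]; infer_instance
  have hstep : ∀ m, ⁅P.lowerCentralSeries (m + 2), P⁆ = ⊥ →
      ⁅P.lowerCentralSeries (m + 1), P⁆ = ⊥ := by
    intro m hm
    refine h _ (P.lowerCentralSeries_le_self _) (hnormal _) (le_bot_iff.mp ?_)
    -- the three subgroups lemma gives `⁅⁅P, P⁆, P.lowerCentralSeries (m + 1)⁆ = ⊥`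
    calc ⁅P.lowerCentralSeries (m + 1), P.lowerCentralSeries (m + 1)⁆
        ≤ ⁅⁅P, P⁆, P.lowerCentralSeries (m + 1)⁆ := Subgroup.commutator_mono
          (P.lowerCentralSeries_antitone (show 1 ≤ m + 1 by omega)) le_rfl
      _ = ⊥ := Subgroup.commutator_commutator_eq_bot_of_rotate
          (by rw [Subgroup.commutator_comm P]; exact hm) hm
  have hdescend : ∀ m, ⁅P.lowerCentralSeries (m + 1), P⁆ = ⊥ → ⁅P.lowerCentralSeries 1, P⁆ = ⊥ := by
    intro m
    induction m with
    | zero => exact id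
    | succ m ih => exact fun hm => ih (hstep m hm)
  refine hdescend n (le_bot_iff.mp ?_)
  calc ⁅P.lowerCentralSeries (n + 1), P⁆ ≤ P.lowerCentralSeries n :=
        (Subgroup.commutator_le_left _ _).trans (P.lowerCentralSeries_antitone n.le_succ)
    _ = ⊥ := hn

theorem commutator_le_center_of_commutator_commutator_eq_bot {J : Type*} [Group J] {P : Subgroup J}
    (h : ⁅⁅P, P⁆, P⁆ = ⊥) : commutator P ≤ Subgroup.center P := by
  rw [commutator_def, ← Subgroup.centralizer_univ, ← Subgroup.coe_top,
    ← Subgroup.commutator_eq_bot_iff_le_centralizer,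
    ← Subgroup.map_eq_bot_iff_of_injective _ P.subtype_injective, Subgroup.map_commutator,
    Subgroup.map_commutator, ← MonoidHom.range_eq_map, P.range_subtype, h]

theorem natCast_card_ne_zero_of_isPGroup {p : ℕ} [Fact p.Prime] {P k : Type*} [Group P] [Finite P]
    [Semiring k] [NoZeroDivisors k] (hP : IsPGroup p P) (hp : (p : k) ≠ 0) :
    (Nat.card P : k) ≠ 0 := by
  obtain ⟨n, hn⟩ := IsPGroup.iff_card.mp hP
  rw [hn, Nat.cast_pow]
  exact pow_ne_zero _ hp

section Representation

variable {k P V : Type*} [Field k] [Group P] [AddCommGroup V] [Module k V]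
  {ρ : Representation k P V}

theorem actionKernel_asModule_eq_bot (hρ : Function.Injective ρ) :
    actionKernel (MonoidAlgebra.of k P) ρ.asModule = ⊥ := by
  refine (Subgroup.eq_bot_iff_forall _).mpr fun x hx => hρ ?_
  rw [map_one]
  ext v
  refine ρ.asModuleEquiv.symm.injective ?_
  rw [Representation.asModuleEquiv_symm_map_rho, mem_actionKernel.mp hx]
  rfl

variable [Finite P] [Finite V]

theorem card_le_card_of_injective_of_isMulCommutative [IsMulCommutative P]
    (hρ : Function.Injective ρ) (hk : (Nat.card P : k) ≠ 0) : Nat.card P ≤ Nat.card V := by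
  have : NeZero (Nat.card P : k) := ⟨hk⟩
  have : Finite ρ.asModule := ‹Finite V›
  rw [← Subgroup.index_bot, ← actionKernel_asModule_eq_bot hρ]
  exact index_actionKernel_le_card fun x => Semigroup.mem_center_iff.mpr fun r =>
    (MonoidAlgebra.of_commute (fun y => mul_comm' x y) r).symm

theorem index_center_le_card_of_injective (hρ : Function.Injective ρ)
    (hk : (Nat.card P : k) ≠ 0) (hP : commutator P ≤ Subgroup.center P) :
    (Subgroup.center P).index ≤ Nat.card V := by
  have : NeZero (Nat.card P : k) := ⟨hk⟩
  have : Finite ρ.asModule := ‹Finite V›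
  have hcenter : actionCenter (MonoidAlgebra.of k P) ρ.asModule ≤ Subgroup.center P := by
    intro x hx
    simp only [mem_actionCenter, actionKernel_asModule_eq_bot hρ, Subgroup.mem_bot] at hx
    exact Subgroup.mem_center_iff.mpr fun g =>
      (commutatorElement_eq_one_iff_mul_comm.mp (hx g)).symm
  refine (Nat.le_of_dvd (Nat.pos_of_ne_zero Subgroup.index_ne_zero_of_finite)
    (Subgroup.index_dvd_of_le hcenter)).trans (index_actionCenter_le_card fun x y =>
      Semigroup.mem_center_iff.mpr fun r => (MonoidAlgebra.of_commute (fun z => ?_) r).symm)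
  exact (Subgroup.mem_center_iff.mp
    (hP (Subgroup.commutator_mem_commutator (Subgroup.mem_top x) (Subgroup.mem_top y))) z).symm

end Representation

variable {k J V : Type*} [Field k] [Finite k] [Group J] [Finite J] [AddCommGroup V] [Module k V]
  [Finite V] {ρ : Representation k J V} {p : ℕ} [Fact p.Prime] {P : Subgroup J} [P.Normal]

theorem exists_normal_le_centralizer_relIndex_le (hρ : Function.Injective ρ) (hp : (p : k) ≠ 0)
    (hP : IsPGroup p P) {A : Subgroup J} [A.Normal] [IsMulCommutative A] (hAP : A ≤ P) :
    ∃ T ≤ P, T.Normal ∧ T ≤ Subgroup.centralizer A ∧ T.relIndex P ≤ Nat.card V := by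
  have : FiniteDimensional k V := Module.Finite.of_finite
  obtain ⟨n, hn, f, hf⟩ := exists_perm_hom hρ (natCast_card_ne_zero_of_isPGroup (hP.to_le hAP) hp)
  refine ⟨f.ker ⊓ P, inf_le_right, inferInstance, inf_le_left.trans hf, ?_⟩
  calc (f.ker ⊓ P).relIndex P = Nat.card (P.map f) := by
        rw [Subgroup.inf_relIndex_right, Subgroup.relIndex_ker]
    _ ≤ 2 ^ n := by simpa using card_le_two_pow_of_isPGroup_perm (hP.map f)
    _ ≤ 2 ^ Module.finrank k V := Nat.pow_le_pow_right two_pos hn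
    _ ≤ Nat.card k ^ Module.finrank k V := Nat.pow_le_pow_left Finite.one_lt_card _
    _ = Nat.card V := Module.natCard_eq_pow_finrank.symm

theorem exists_normal_lt_relIndex_le (hρ : Function.Injective ρ) (hp : (p : k) ≠ 0)
    (hP : IsPGroup p P) (hPbot : P ≠ ⊥) :
    ∃ Y < P, Y.Normal ∧ Y.relIndex P ≤ Nat.card V := by
  have hρP : Function.Injective (ρ.comp P.subtype) := hρ.comp P.subtype_injective
  have hk := natCast_card_ne_zero_of_isPGroup hP hp
  by_cases hab : ∀ A : Subgroup J, A ≤ P → A.Normal → ⁅A, A⁆ = ⊥ → ⁅A, P⁆ = ⊥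
  · by_cases hcomm : IsMulCommutative P
    · refine ⟨⊥, hPbot.bot_lt, inferInstance, ?_⟩
      rw [Subgroup.relIndex_bot_left]
      exact card_le_card_of_injective_of_isMulCommutative hρP hk
    · have : Group.IsNilpotent P := hP.isNilpotent
      have hclass := commutator_commutator_eq_bot_of_forall_abelian P hab
      have hsub : ((Subgroup.center P).map P.subtype).subgroupOf P = Subgroup.center P :=
        Subgroup.comap_map_eq_self_of_injective P.subtype_injective _
      refine ⟨(Subgroup.center P).map P.subtype, (Subgroup.map_subtype_le _).lt_of_ne fun h => ?_,
        ConjAct.normal_of_characteristic_of_normal, ?_⟩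
      · rw [h, Subgroup.subgroupOf_self] at hsub
        exact hcomm (Subgroup.center_eq_top_iff.mp hsub.symm)
      · rw [Subgroup.relIndex, hsub]
        exact index_center_le_card_of_injective hρP hk
          (commutator_le_center_of_commutator_commutator_eq_bot hclass)
  · push Not at hab
    obtain ⟨A, hAP, hAn, hA, hAP'⟩ := hab
    have : IsMulCommutative A := Subgroup.le_centralizer_iff_isMulCommutative.mp
      (Subgroup.commutator_eq_bot_iff_le_centralizer.mp hA)
    obtain ⟨T, hTP, hTn, hT, hidx⟩ := exists_normal_le_centralizer_relIndex_le hρ hp hP hAP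
    refine ⟨T, hTP.lt_of_ne ?_, hTn, hidx⟩
    rintro rfl
    exact hAP' (Subgroup.commutator_comm A T ▸ Subgroup.commutator_eq_bot_iff_le_centralizer.mpr hT)

end PGroupsInCoprimeCharacteristic

section MinimalNormalSubgroups

variable {G : Type*} [Group G]

/-- `B` is a minimal normal subgroup: minimal among the nontrivial normal subgroups. -/
def IsMinimalNormal (B : Subgroup G) : Prop :=
  Minimal (fun K : Subgroup G => K.Normal ∧ K ≠ ⊥) B

theorem exists_isMinimalNormal_le [Finite G] (N : Subgroup G) [hN : N.Normal] (hne : N ≠ ⊥) :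
    ∃ B ≤ N, IsMinimalNormal B :=
  Finite.exists_le_minimal ⟨hN, hne⟩

namespace IsMinimalNormal

variable {B : Subgroup G}

theorem normal (hB : IsMinimalNormal B) : B.Normal := hB.prop.1

theorem ne_bot (hB : IsMinimalNormal B) : B ≠ ⊥ := hB.prop.2

theorem eq_of_le (hB : IsMinimalNormal B) {K : Subgroup G} [hK : K.Normal] (hK0 : K ≠ ⊥)
    (hKB : K ≤ B) : K = B :=
  le_antisymm hKB (hB.le_of_le ⟨hK, hK0⟩ hKB)

theorem isMulCommutative [Group.IsSolvable G] (hB : IsMinimalNormal B) : IsMulCommutative B := by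
  have := hB.normal
  have hlt := Group.IsSolvable.commutator_lt_of_ne_bot hB.ne_bot
  rw [← Subgroup.le_centralizer_iff_isMulCommutative,
    ← Subgroup.commutator_eq_bot_iff_le_centralizer]
  by_contra h
  exact hlt.ne (hB.eq_of_le h hlt.le)

end IsMinimalNormal

end MinimalNormalSubgroups

section Nilpotency

variable {G : Type*} [Group G] {M X : Subgroup G} {p : ℕ}

theorem isSimpleGroup_quotient_of_isCoatom [M.Normal] (hM : IsCoatom M) :
    IsSimpleGroup (G ⧸ M) where
  exists_pair_ne := (QuotientGroup.nontrivial_iff.mpr hM.1).exists_pair_ne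
  eq_bot_or_eq_top_of_normal K _ := by
    have hsurj := QuotientGroup.mk'_surjective M
    have hle : M ≤ K.comap (QuotientGroup.mk' M) := by
      conv_lhs => rw [← QuotientGroup.ker_mk' M]
      exact Subgroup.ker_le_comap _ _
    rw [← Subgroup.map_comap_eq_self_of_surjective hsurj K]
    rcases hM.le_iff.mp hle with h | h
    · exact .inr (by rw [h, Subgroup.map_top_of_surjective _ hsurj])
    · exact .inl (by rw [h, QuotientGroup.map_mk'_self])

theorem isCyclic_quotient_of_isCoatom [M.Normal] (hM : IsCoatom M) : IsCyclic (G ⧸ M) := by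
  obtain ⟨x, -, hx⟩ := SetLike.exists_of_lt hM.1.lt_top
  have hle : M ≤ (Subgroup.zpowers (x : G ⧸ M)).comap (QuotientGroup.mk' M) := by
    conv_lhs => rw [← QuotientGroup.ker_mk' M]
    exact Subgroup.ker_le_comap _ _
  have htop : (Subgroup.zpowers (x : G ⧸ M)).comap (QuotientGroup.mk' M) = ⊤ :=
    (hM.le_iff.mp hle).resolve_right fun h => hx (h.le (Subgroup.mem_zpowers (x : G ⧸ M)))
  refine ⟨(x : G ⧸ M), fun y => ?_⟩
  obtain ⟨y, rfl⟩ := QuotientGroup.mk_surjective y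
  exact htop.ge (Subgroup.mem_top y)

theorem index_prime_of_isCoatom [M.Normal] (hM : IsCoatom M) : M.index.Prime := by
  have := isCyclic_quotient_of_isCoatom hM
  have := isSimpleGroup_quotient_of_isCoatom hM
  have : IsMulCommutative (G ⧸ M) := inferInstance
  exact Group.is_simple_iff_prime_card.mp inferInstance

theorem commutator_le_of_isCoatom [M.Normal] (hM : IsCoatom M) : commutator G ≤ M := by
  have := isCyclic_quotient_of_isCoatom hM
  exact Subgroup.Normal.quotient_commutative_iff_commutator_le.mp inferInstance

theorem isNilpotent_of_commutator_le_frattini [Finite G] (h : commutator G ≤ frattini G) :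
    Group.IsNilpotent G :=
  (Group.isNilpotent_of_finite_tfae.out 0 2 rfl rfl).mpr fun _ hM =>
    Subgroup.Normal.of_commutator_le G (h.trans (frattini_le_coatom hM))

theorem map_subtype_sup_normal_of_isNilpotent [Finite G] {N : Subgroup G} [N.Normal]
    {X : Subgroup (G ⧸ N)} [X.Normal] [Group.IsNilpotent X] [Fact p.Prime]
    (Q : Sylow p (X.comap (QuotientGroup.mk' N))) :
    (Q.toSubgroup.map (Subgroup.subtype _) ⊔ N).Normal := by
  let π := (QuotientGroup.mk' N).subgroupComap X
  have hπ : Function.Surjective π :=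
    (QuotientGroup.mk' N).subgroupComap_surjective_of_surjective X (QuotientGroup.mk'_surjective N)
  have hchar : (Q.mapSurjective hπ : Subgroup X).Characteristic :=
    Sylow.characteristic_of_normal _ inferInstance
  have hnormal : ((Q.mapSurjective hπ : Subgroup X).map X.subtype).Normal :=
    ConjAct.normal_of_characteristic_of_normal
  have hmap : (Q.mapSurjective hπ : Subgroup X).map X.subtype =
      (Q.toSubgroup.map (Subgroup.subtype _)).map (QuotientGroup.mk' N) := by
    rw [Sylow.coe_mapSurjective, Subgroup.map_map, Subgroup.map_map]
    rfl
  rw [hmap] at hnormal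
  have := hnormal.comap (QuotientGroup.mk' N)
  rwa [Subgroup.comap_map_eq, QuotientGroup.ker_mk'] at this

theorem not_dvd_relIndex_of_sylow_map_subtype_le {K : Subgroup G} (Q : Sylow p X)
    [Fact p.Prime] [Finite G] (hKX : K ≤ X) (hQK : Q.toSubgroup.map X.subtype ≤ K) :
    ¬ p ∣ (Q.toSubgroup.map X.subtype).relIndex K := by
  intro hdvd
  apply Q.not_dvd_index
  rw [← Subgroup.comap_map_eq_self_of_injective X.subtype_injective Q.toSubgroup]
  exact (hdvd.mul_right _).trans (Subgroup.relIndex_mul_relIndex _ K X hQK hKX).dvd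

/-- The Frattini argument, modulo the Frattini subgroup. -/
theorem normal_of_sup_frattini_normal [Finite G] [Fact p.Prime] {R : Subgroup G}
    (hR : IsPGroup p R) (hnormal : (R ⊔ frattini G).Normal)
    (hindex : ¬ p ∣ R.relIndex (R ⊔ frattini G)) : R.Normal := by
  let S : Sylow p (R ⊔ frattini G : Subgroup G) :=
    (hR.comap_subtype (K := R ⊔ frattini G)).toSylow hindex
  have hS : (S : Subgroup (R ⊔ frattini G : Subgroup G)).map (Subgroup.subtype _) = R :=
    (Subgroup.subgroupOf_map_subtype R _).trans (inf_eq_left.mpr le_sup_left)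
  have hfrattini := Sylow.normalizer_sup_eq_top S
  rw [hS, ← sup_assoc, sup_eq_left.mpr Subgroup.le_normalizer] at hfrattini
  exact Subgroup.normalizer_eq_top_iff.mp (frattini_nongenerating hfrattini)

theorem sylow_map_subtype_normal_of_isNilpotent [Finite G] {X : Subgroup (G ⧸ frattini G)}
    [X.Normal] [Group.IsNilpotent X] [Fact p.Prime]
    (Q : Sylow p (X.comap (QuotientGroup.mk' (frattini G)))) :
    (Q.toSubgroup.map (Subgroup.subtype _)).Normal := by
  refine normal_of_sup_frattini_normal (Q.isPGroup'.map _)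
    (map_subtype_sup_normal_of_isNilpotent Q) (not_dvd_relIndex_of_sylow_map_subtype_le Q
      (sup_le (Subgroup.map_subtype_le _) ?_) le_sup_left)
  conv_lhs => rw [← QuotientGroup.ker_mk' (frattini G)]
  exact Subgroup.ker_le_comap _ _

theorem le_of_forall_sylow_map_subtype_le [Finite G] {Z : Subgroup G}
    (h : ∀ (p : ℕ) (_ : Fact p.Prime) (Q : Sylow p X), Q.toSubgroup.map X.subtype ≤ Z) :
    X ≤ Z := by
  rw [← Subgroup.subgroupOf_eq_top, ← Subgroup.index_eq_one]
  by_contra hne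
  obtain ⟨p, hp, hdvd⟩ := Nat.exists_prime_and_dvd hne
  have : Fact p.Prime := ⟨hp⟩
  obtain ⟨Q⟩ : Nonempty (Sylow p X) := inferInstance
  exact Q.not_dvd_index (hdvd.trans (Subgroup.index_dvd_of_le
    (Subgroup.map_le_iff_le_comap.mp (h p this Q))))

theorem isNilpotent_comap_mk'_center {B : Subgroup (G ⧸ Subgroup.center G)}
    [Group.IsNilpotent B] :
    Group.IsNilpotent (B.comap (QuotientGroup.mk' (Subgroup.center G))) := by
  refine Subgroup.isNilpotent_of_ker_le_center
    ((QuotientGroup.mk' (Subgroup.center G)).subgroupComap B) fun x hx => ?_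
  have hx : (x : G) ∈ Subgroup.center G :=
    (QuotientGroup.eq_one_iff _).mp (congrArg Subtype.val hx)
  exact Subgroup.mem_center_iff.mpr fun g => Subtype.ext (Subgroup.mem_center_iff.mp hx g)

open scoped IsMulCommutative in
theorem center_eq_top_of_forall_isNilpotent_le_center [Finite G] [Group.IsSolvable G]
    (h : ∀ X : Subgroup G, X.Normal → Group.IsNilpotent X → X ≤ Subgroup.center G) :
    Subgroup.center G = ⊤ := by
  by_contra hC
  have := QuotientGroup.nontrivial_iff.mpr hC
  obtain ⟨B, -, hB⟩ :=
    exists_isMinimalNormal_le (⊤ : Subgroup (G ⧸ Subgroup.center G)) bot_ne_top.symm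
  have := hB.isMulCommutative
  have : Group.IsNilpotent B := inferInstance
  have hle := h _ (hB.normal.comap _) isNilpotent_comap_mk'_center
  refine hB.ne_bot (eq_bot_iff.mpr fun b hb => ?_)
  obtain ⟨b, rfl⟩ := QuotientGroup.mk_surjective b
  exact (QuotientGroup.eq_one_iff b).mpr (hle hb)

theorem isNilpotent_of_forall_normal_isPGroup_commutator_le_frattini [Finite G]
    [Group.IsSolvable G]
    (h : ∀ (p : ℕ) (_ : Fact p.Prime) (P : Subgroup G), P.Normal → IsPGroup p P →
      ⁅P, (⊤ : Subgroup G)⁆ ≤ frattini G) : Group.IsNilpotent G := by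
  have hcenter : Subgroup.center (G ⧸ frattini G) = ⊤ := by
    refine center_eq_top_of_forall_isNilpotent_le_center fun X hX hXnil => ?_
    have hsurj := QuotientGroup.mk'_surjective (frattini G)
    rw [← Subgroup.comap_le_comap_of_surjective hsurj]
    refine le_of_forall_sylow_map_subtype_le fun p hp Q x hx => ?_
    have hQ := h p hp _ (sylow_map_subtype_normal_of_isNilpotent Q) (Q.isPGroup'.map _)
    rw [Subgroup.mem_comap, Subgroup.mem_center_iff]
    intro g
    obtain ⟨g, rfl⟩ := QuotientGroup.mk_surjective g
    have hxg : ⁅(x : G ⧸ frattini G), (g : G ⧸ frattini G)⁆ = 1 :=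
      (QuotientGroup.eq_one_iff ⁅x, g⁆).mpr (hQ (Subgroup.commutator_mem_commutator hx trivial))
    exact (commutatorElement_eq_one_iff_mul_comm.mp hxg).symm
  have := Subgroup.center_eq_top_iff.mp hcenter
  exact isNilpotent_of_commutator_le_frattini
    (Subgroup.Normal.quotient_commutative_iff_commutator_le.mp this)

theorem exists_normal_isPGroup_not_le_isCoatom [Finite G] [Group.IsSolvable G]
    (hG : ¬ Group.IsNilpotent G) :
    ∃ (p : ℕ) (_ : Fact p.Prime) (P M : Subgroup G), P.Normal ∧ IsPGroup p P ∧ IsCoatom M ∧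
      ¬ M.Normal ∧ ¬ P ≤ M := by
  by_contra! hcon
  refine hG (isNilpotent_of_forall_normal_isPGroup_commutator_le_frattini fun p hp P hP hPp =>
    le_iInf₂ fun M hM => ?_)
  by_cases hMn : M.Normal
  · exact (Subgroup.commutator_mono le_top le_rfl).trans (commutator_le_of_isCoatom hM)
  · exact (Subgroup.commutator_le_left _ _).trans (hcon p hp P M hP hPp hM hMn)

end Nilpotency

section IrreducibleLinearGroups

theorem index_eq_relIndex_of_sup_eq_top {G : Type*} [Group G] {P M : Subgroup G} [P.Normal]
    [P.FiniteIndex] (h : P ⊔ M = ⊤) : M.index = M.relIndex P := by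
  have hP : P.relIndex M = P.index := by
    rw [← Subgroup.relIndex_sup_left, h, Subgroup.relIndex_top_right]
  refine Nat.eq_of_mul_eq_mul_left (Nat.pos_of_ne_zero P.index_ne_zero_of_finite) ?_
  calc P.index * M.index = (P ⊓ M).index := by
        rw [← hP, ← Subgroup.inf_relIndex_right, Subgroup.relIndex_mul_index inf_le_right]
    _ = P.index * M.relIndex P := by
        rw [← Subgroup.relIndex_mul_index inf_le_left, Subgroup.inf_relIndex_left, mul_comm]

variable {k G V : Type*} [Field k] [Group G] [AddCommGroup V] [Module k V]
  [Nontrivial V] {ρ : Representation k G V} {p : ℕ} [Fact p.Prime] {P : Subgroup G} [P.Normal]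

theorem natCast_card_eq_zero : (Nat.card V : k) = 0 := by
  obtain ⟨v, hv⟩ := exists_ne (0 : V)
  have h : (Nat.card V : k) • v = 0 := by rw [Nat.cast_smul_eq_nsmul, card_nsmul_eq_zero']
  exact (smul_eq_zero.mp h).resolve_right hv

theorem dvd_card_of_natCast_eq_zero (hp : (p : k) = 0) : p ∣ Nat.card V := by
  obtain ⟨v, hv⟩ := exists_ne (0 : V)
  have h : p • v = 0 := by rw [← Nat.cast_smul_eq_nsmul k, hp, zero_smul]
  exact addOrderOf_eq_prime h hv ▸ addOrderOf_dvd_natCard v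

variable [Finite V]

theorem eq_bot_of_isPGroup_of_natCast_eq_zero [ρ.IsIrreducible] (hρ : Function.Injective ρ)
    (hP : IsPGroup p P) (hp : (p : k) = 0) : P = ⊥ := by
  let W : Subrepresentation ρ :=
    ⟨Representation.invariants (ρ.comp P.subtype), fun g _ hw => ρ.le_comap_invariants P g hw⟩
  have hW : W = ⊤ := by
    refine (eq_bot_or_eq_top W).resolve_left fun h => ?_
    let _ : MulAction P V := MulAction.compHom V (ρ.comp P.subtype)
    obtain ⟨v, hv, hv0⟩ := hP.exists_fixed_point_of_prime_dvd_card_of_fixed_point V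
      (dvd_card_of_natCast_eq_zero hp) (a := 0) fun x => map_zero (ρ x)
    have hvW : v ∈ W.toSubmodule := hv
    rw [h] at hvW
    exact hv0 hvW.symm
  refine eq_bot_iff.mpr fun x hx => Subgroup.mem_bot.mpr (hρ ?_)
  ext v
  have hv : v ∈ W.toSubmodule := hW ▸ Submodule.mem_top
  rw [map_one]
  exact hv ⟨x, hx⟩

theorem exists_not_normal_isCoatom_index_lt [Finite k] [Finite G] [Group.IsSolvable G]
    [ρ.IsIrreducible] (hρ : Function.Injective ρ) (hG : ¬ Group.IsNilpotent G) :
    ∃ M : Subgroup G, IsCoatom M ∧ ¬ M.Normal ∧ M.index < Nat.card V := by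
  obtain ⟨p, hp, P₀, M, hP₀, hP₀p, hM, hMn, hP₀M⟩ := exists_normal_isPGroup_not_le_isCoatom hG
  obtain ⟨P, hPP₀, hPmin⟩ := Finite.exists_le_minimal
    (p := fun K : Subgroup G => K.Normal ∧ ¬ K ≤ M) ⟨hP₀, hP₀M⟩
  obtain ⟨hPn, hPM⟩ := hPmin.prop
  have hPp : IsPGroup p P := hP₀p.to_le hPP₀
  have hPbot : P ≠ ⊥ := fun h => hPM (h ▸ bot_le)
  have hpk : (p : k) ≠ 0 := fun h => hPbot (eq_bot_of_isPGroup_of_natCast_eq_zero hρ hPp h)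
  obtain ⟨Y, hYP, hYn, hYV⟩ := exists_normal_lt_relIndex_le hρ hpk hPp hPbot
  have hYM : Y ≤ M := by
    by_contra h
    exact hYP.not_ge (hPmin.le_of_le ⟨hYn, h⟩ hYP.le)
  have hne : M.relIndex P ≠ Nat.card V := by
    obtain ⟨n, hn⟩ := hPp.index (M.subgroupOf P)
    intro h
    have hV := natCast_card_eq_zero (k := k) (V := V)
    rw [← h, Subgroup.relIndex, hn, Nat.cast_pow] at hV
    exact hpk (eq_zero_of_pow_eq_zero hV)
  refine ⟨M, hM, hMn, ?_⟩
  calc M.index = M.relIndex P :=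
        index_eq_relIndex_of_sup_eq_top (hM.2 _ (right_lt_sup.mpr hPM))
    _ < Nat.card V :=
        ((Subgroup.relIndex_le_of_le_left hYM
          (Nat.card_pos (α := P ⧸ Y.subgroupOf P)).ne').trans hYV).lt_of_ne hne

end IrreducibleLinearGroups

section CoveringNumber

variable {G H ι : Type*} [Group G] [Group H]

theorem coveringNumber_le_card [Finite ι] (K : ι → Subgroup G) (hK : ∀ i, K i ≠ ⊤)
    (hcover : ∀ g, ∃ i, g ∈ K i) : coveringNumber G ≤ Nat.card ι := by
  refine Nat.sInf_le ⟨fun i => K ((Finite.equivFin ι).symm i), fun i => hK _, ?_⟩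
  refine Set.iUnion_eq_univ_iff.mpr fun g => ?_
  obtain ⟨i, hi⟩ := hcover g
  exact ⟨Finite.equivFin ι i, by simpa using hi⟩

theorem exists_cover [Finite G] (hG : ¬ IsCyclic G) :
    ∃ K : Fin (coveringNumber G) → Subgroup G, (∀ i, K i ≠ ⊤) ∧ ∀ g, ∃ i, g ∈ K i := by
  obtain ⟨K, hK, hcover⟩ := (coveringNumber_isLeast G hG).1
  exact ⟨K, hK, Set.iUnion_eq_univ_iff.mp hcover⟩

theorem coveringNumber_le_of_surjective [Finite H] (hH : ¬ IsCyclic H) (f : G →* H)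
    (hf : Function.Surjective f) : coveringNumber G ≤ coveringNumber H := by
  obtain ⟨K, hK, hcover⟩ := exists_cover hH
  refine (coveringNumber_le_card (fun i => (K i).comap f) (fun i h => hK i ?_)
    fun g => hcover (f g)).trans_eq (Nat.card_fin _)
  rw [← Subgroup.map_comap_eq_self_of_surjective hf (K i), h, Subgroup.map_top_of_surjective f hf]

variable {p : ℕ} [Fact p.Prime]

theorem exists_hom_zmod_ker_eq {M : Subgroup G} [M.Normal] (hM : M.index = p) :
    ∃ f : G →* Multiplicative (ZMod p), f.ker = M := by
  let e : G ⧸ M ≃* Multiplicative (ZMod p) :=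
    mulEquivOfPrimeCardEq (p := p) hM (by rw [Nat.card_congr Multiplicative.toAdd, Nat.card_zmod])
  exact ⟨e.toMonoidHom.comp (QuotientGroup.mk' M),
    (MonoidHom.ker_mulEquiv_comp _ e).trans (QuotientGroup.ker_mk' M)⟩

/-- The kernel of `f₁` and those of `f₂ / f₁ ^ n` for `n < p` cover. -/
theorem coveringNumber_le_prime_add_one {C : Type*} [CommGroup C] (hC : Nat.card C = p)
    {f₁ f₂ : G →* C} (h₁ : f₁ ≠ 1) (hker : ¬ f₁.ker ≤ f₂.ker) : coveringNumber G ≤ p + 1 := by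
  have hle := coveringNumber_le_card
    (fun o : Option (Fin p) => o.elim f₁.ker fun n => (f₂ / f₁ ^ (n : ℕ)).ker) ?_ ?_
  · rwa [Finite.card_option, Nat.card_fin] at hle
  · rintro (_ | n) htop
    · exact h₁ ((MonoidHom.ker_eq_top_iff).mp htop)
    · refine hker fun x hx => ?_
      have hxn : f₂ x / f₁ x ^ (n : ℕ) = 1 := htop.ge (Subgroup.mem_top x)
      rwa [MonoidHom.mem_ker.mp hx, one_pow, div_one] at hxn
  · intro g
    by_cases hg : f₁ g = 1
    · exact ⟨none, hg⟩
    · obtain ⟨n, hn⟩ := mem_powers_of_prime_card (p := p) hC hg (g' := f₂ g)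
      refine ⟨some ⟨n % p, n.mod_lt (Fact.out : p.Prime).pos⟩, ?_⟩
      change f₂ g / f₁ g ^ (n % p) = 1
      rw [← hC, pow_mod_natCard, show f₁ g ^ n = f₂ g from hn, div_self']

theorem coveringNumber_le_of_isPGroup [Finite G] (hG : IsPGroup p G) (hc : ¬ IsCyclic G) :
    coveringNumber G ≤ p + 1 := by
  have hnormal : ∀ M : Subgroup G, IsCoatom M → M.Normal :=
    (Group.isNilpotent_of_finite_tfae.out 0 2 rfl rfl).mp hG.isNilpotent
  have hindex : ∀ M : Subgroup G, IsCoatom M → M.index = p := by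
    intro M hM
    have := hnormal M hM
    have hprime := index_prime_of_isCoatom hM
    obtain ⟨n, hn⟩ := hG.index M
    rw [hn] at hprime ⊢
    rw [Nat.Prime.eq_one_of_pow hprime, pow_one]
  have hmem : ∀ x : G, ∃ M : Subgroup G, IsCoatom M ∧ x ∈ M := by
    intro x
    rcases eq_top_or_exists_le_coatom (Subgroup.zpowers x) with h | ⟨M, hM, hxM⟩
    · exact absurd ⟨x, fun y => (Subgroup.eq_top_iff' _).mp h y⟩ hc
    · exact ⟨M, hM, hxM (Subgroup.mem_zpowers x)⟩
  obtain ⟨M₁, hM₁, -⟩ := hmem 1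
  obtain ⟨x, -, hx⟩ := SetLike.exists_of_lt hM₁.1.lt_top
  obtain ⟨M₂, hM₂, hx₂⟩ := hmem x
  have := hnormal M₁ hM₁
  have := hnormal M₂ hM₂
  obtain ⟨f₁, rfl⟩ := exists_hom_zmod_ker_eq (hindex M₁ hM₁)
  obtain ⟨f₂, rfl⟩ := exists_hom_zmod_ker_eq (hindex M₂ hM₂)
  refine coveringNumber_le_prime_add_one (C := Multiplicative (ZMod p)) (f₁ := f₁) (f₂ := f₂)
    (Nat.card_zmod p) (fun h => hM₁.1 (MonoidHom.ker_eq_top_iff.mpr h)) fun hle => hx ?_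
  rcases hM₁.le_iff.mp hle with h | h
  · exact absurd h hM₂.1
  · exact h ▸ hx₂

theorem exists_surjective_hom_sylow [Finite G] (hG : Group.IsNilpotent G) (P : Sylow p G) :
    ∃ f : G →* P, Function.Surjective f := by
  by_cases hp : p ∈ (Nat.card G).primeFactors
  · obtain ⟨e⟩ := (Group.isNilpotent_of_finite_tfae.out 0 4 rfl rfl).mp hG
    let π₁ := Pi.evalMonoidHom
      (fun q : (Nat.card G).primeFactors => ∀ Q : Sylow q G, (Q : Subgroup G)) ⟨p, hp⟩
    let π₂ := Pi.evalMonoidHom (fun Q : Sylow p G => (Q : Subgroup G)) P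
    have hπ₁ : Function.Surjective π₁ := Function.surjective_eval _
    have hπ₂ : Function.Surjective π₂ := Function.surjective_eval _
    exact ⟨(π₂.comp π₁).comp e.symm.toMonoidHom, (hπ₂.comp hπ₁).comp e.symm.surjective⟩
  · have : Subsingleton P := by
      rw [← Nat.support_factorization, Finsupp.notMem_support_iff] at hp
      rw [← Finite.card_le_one_iff_subsingleton, P.card_eq_multiplicity, hp, pow_zero]
    exact ⟨1, fun x => ⟨1, Subsingleton.elim _ _⟩⟩

end CoveringNumber

section FaithfulActions

variable {P V : Type*} [Group P] [Monoid V] [Finite V] [MulDistribMulAction P V]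
  [FaithfulSMul P V]

theorem prime_lt_card_of_isPGroup [Nontrivial P] {p : ℕ} [Fact p.Prime] (hP : IsPGroup p P) :
    p < Nat.card V := by
  obtain ⟨x, hx⟩ := exists_ne (1 : P)
  obtain ⟨v, hv⟩ : ∃ v : V, x • v ≠ v := by
    by_contra! h
    exact hx (FaithfulSMul.eq_of_smul_eq_smul fun v : V => (h v).trans (one_smul P v).symm)
  obtain ⟨n, hn⟩ := hP.card_orbit v
  have hn0 : n ≠ 0 := by
    rintro rfl
    rw [pow_zero, Nat.card_eq_one_iff_unique] at hn
    have := hn.1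
    exact hv (Set.subsingleton_coe _ |>.mp this (MulAction.mem_orbit v x)
      (MulAction.mem_orbit_self v))
  have h1 : MulAction.orbit P v ≠ Set.univ := by
    intro h
    obtain ⟨y, hy : y • v = 1⟩ : (1 : V) ∈ MulAction.orbit P v := h ▸ Set.mem_univ 1
    have hv1 : v = 1 := by rw [← inv_smul_smul y v, hy, smul_one]
    exact hv (by rw [hv1, smul_one])
  calc p ≤ p ^ n := Nat.le_self_pow hn0 p
    _ = (MulAction.orbit P v).ncard := hn.symm
    _ < Nat.card V := Set.ncard_lt_card h1

theorem coveringNumber_le_card_of_isNilpotent {G : Type*} [Group G] [Finite G]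
    [MulDistribMulAction G V] [FaithfulSMul G V] (hG : Group.IsNilpotent G) (hc : ¬ IsCyclic G) :
    coveringNumber G ≤ Nat.card V := by
  obtain ⟨p, hp, P, hPc⟩ : ∃ (p : ℕ) (_ : p.Prime) (P : Sylow p G), ¬ IsCyclic P := by
    by_contra! h
    have : IsZGroup G := ⟨h⟩
    exact hc inferInstance
  have : Fact p.Prime := ⟨hp⟩
  have : Nontrivial P := not_subsingleton_iff_nontrivial.mp fun _ => hPc inferInstance
  obtain ⟨f, hf⟩ := exists_surjective_hom_sylow hG P
  calc coveringNumber G ≤ coveringNumber P := coveringNumber_le_of_surjective hPc f hf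
    _ ≤ p + 1 := coveringNumber_le_of_isPGroup P.isPGroup' hPc
    _ ≤ Nat.card V := prime_lt_card_of_isPGroup P.isPGroup'

end FaithfulActions

section PrimitiveGroups

open scoped Pointwise

variable {G : Type*} [Group G] {B L : Subgroup G} {p : ℕ}

theorem normal_of_sup_eq_top {H K N : Subgroup G} (h : H ⊔ K = ⊤)
    (hH : H ≤ Subgroup.centralizer N) (hK : K ≤ Subgroup.normalizer N) : N.Normal := by
  rw [← Subgroup.normalizer_eq_top_iff, eq_top_iff, ← h]
  exact sup_le (hH.trans (Subgroup.centralizer_le_normalizer _)) hK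

open scoped IsMulCommutative in
theorem IsMinimalNormal.exists_forall_pow_prime_eq_one [Finite G] [Group.IsSolvable G]
    (hB : IsMinimalNormal B) : ∃ p : ℕ, p.Prime ∧ ∀ x : B, x ^ p = 1 := by
  have := hB.normal
  have := hB.isMulCommutative
  obtain ⟨p, hp, hdvd⟩ := Nat.exists_prime_and_dvd fun h => hB.ne_bot (Subgroup.card_eq_one.mp h)
  have : Fact p.Prime := ⟨hp⟩
  let K : Subgroup B := (powMonoidHom p : B →* B).ker
  have : K.Characteristic := by
    refine Subgroup.characteristic_iff_le_comap.mpr fun φ x hx => ?_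
    have hx : x ^ p = 1 := hx
    change φ x ^ p = 1
    rw [← map_pow, hx, map_one]
  have hK : K.map B.subtype = B := by
    refine hB.eq_of_le (fun h0 => ?_) (Subgroup.map_subtype_le K)
    obtain ⟨x, hx⟩ := exists_prime_orderOf_dvd_card' p hdvd
    have hxK : x ∈ K := (hx ▸ pow_orderOf_eq_one x : x ^ p = 1)
    have hK0 : K = ⊥ := (Subgroup.map_eq_bot_iff_of_injective K B.subtype_injective).mp h0
    rw [hK0, Subgroup.mem_bot] at hxK
    rw [hxK, orderOf_one] at hx
    exact hp.one_lt.ne hx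
  refine ⟨p, hp, fun x => ?_⟩
  obtain ⟨y, hy, hyx⟩ := hK.ge x.2
  exact Subtype.ext hyx ▸ hy

theorem IsMinimalNormal.isComplement'_of_not_le [Group.IsSolvable G]
    (hB : IsMinimalNormal B) (hL : IsCoatom L) (hBL : ¬ B ≤ L) : B.IsComplement' L := by
  have := hB.normal
  have hsup : B ⊔ L = ⊤ := sup_comm B L ▸ hL.2 _ (left_lt_sup.mpr hBL)
  have hinf : (B ⊓ L).Normal := by
    refine normal_of_sup_eq_top hsup ?_ ?_
    · have hcent := Subgroup.le_centralizer_iff_isMulCommutative.mpr hB.isMulCommutative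
      exact hcent.trans (Subgroup.centralizer_le fun _ hx => hx.1)
    · exact (le_inf (Subgroup.normalizer_eq_top (H := B) ▸ le_top) Subgroup.le_normalizer).trans
        Subgroup.inf_normalizer_le_normalizer_inf
  refine Subgroup.isComplement'_of_disjoint_and_mul_eq_univ (disjoint_iff.mpr ?_) ?_
  · by_contra h0
    exact hBL (inf_eq_left.mp (hB.eq_of_le h0 inf_le_left))
  · rw [← Subgroup.normal_mul, hsup, Subgroup.coe_top]

theorem exists_isMinimalNormal_isComplement' [Finite G] [Group.IsSolvable G] [Nontrivial G]
    (hL : IsCoatom L) (hcore : L.normalCore = ⊥) :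
    ∃ B : Subgroup G, IsMinimalNormal B ∧ B.IsComplement' L := by
  obtain ⟨B, -, hB⟩ := exists_isMinimalNormal_le (⊤ : Subgroup G) top_ne_bot
  have := hB.normal
  exact ⟨B, hB, hB.isComplement'_of_not_le hL fun h =>
    hB.ne_bot (le_bot_iff.mp (hcore ▸ Subgroup.normal_le_normalCore.mpr h))⟩

theorem inf_centralizer_le_normalCore [B.Normal] (h : B ⊔ L = ⊤) :
    L ⊓ Subgroup.centralizer B ≤ L.normalCore := by
  have : (L ⊓ Subgroup.centralizer (B : Set G)).Normal := by
    refine normal_of_sup_eq_top h ?_ ?_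
    · rw [Subgroup.le_centralizer_iff]
      exact inf_le_right
    · exact (le_inf Subgroup.le_normalizer
        (Subgroup.normalizer_eq_top (H := Subgroup.centralizer (B : Set G)) ▸ le_top)).trans
          Subgroup.inf_normalizer_le_normalizer_inf
  exact Subgroup.normal_le_normalCore.mpr inf_le_left

theorem centralizer_eq_of_isComplement' [B.Normal] [IsMulCommutative B] (hBL : B.IsComplement' L)
    (hcore : L.normalCore = ⊥) : Subgroup.centralizer (B : Set G) = B := by
  have hB : B ≤ Subgroup.centralizer B :=
    Subgroup.le_centralizer_iff_isMulCommutative.mpr inferInstance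
  have hinf : L ⊓ Subgroup.centralizer (B : Set G) = ⊥ :=
    le_bot_iff.mp (hcore ▸ inf_centralizer_le_normalCore hBL.sup_eq_top)
  refine SetLike.coe_injective ?_
  calc (Subgroup.centralizer (B : Set G) : Set G)
      = ((B : Set G) * L) ⊓ (Subgroup.centralizer (B : Set G) : Set G) := by
        rw [hBL.mul_eq, inf_eq_right.mpr (Set.subset_univ _)]
    _ = (B : Set G) * (L ⊓ Subgroup.centralizer (B : Set G) : Subgroup G) :=
        (Subgroup.mul_inf_assoc _ _ _ hB).symm
    _ = B := by rw [hinf, Subgroup.coe_bot, Set.singleton_one, mul_one]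

theorem eq_one_of_commute_of_isComplement' [IsMulCommutative B] [IsMulCommutative L]
    (hB : IsMinimalNormal B) (hBL : B.IsComplement' L)
    (hcent : Subgroup.centralizer (B : Set G) = B) {b l : G} (hl : l ∈ L) (hl1 : l ≠ 1)
    (hb : b ∈ B) (hlb : Commute l b) : b = 1 := by
  have := hB.normal
  have hn : (B ⊓ Subgroup.centralizer {l}).Normal := by
    refine normal_of_sup_eq_top hBL.sup_eq_top ?_ ?_
    · exact (Subgroup.le_centralizer_iff_isMulCommutative.mpr ‹_›).trans
        (Subgroup.centralizer_le fun _ hx => hx.1)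
    · refine (le_inf (Subgroup.normalizer_eq_top (H := B) ▸ le_top) ?_).trans
        Subgroup.inf_normalizer_le_normalizer_inf
      refine le_trans (fun c hc => ?_) Subgroup.le_normalizer
      exact Subgroup.mem_centralizer_singleton_iff.mpr (setLike_mul_comm hc hl)
  by_contra hb1
  have hbK : b ∈ B ⊓ Subgroup.centralizer {l} :=
    ⟨hb, Subgroup.mem_centralizer_singleton_iff.mpr hlb.eq.symm⟩
  have hK := hB.eq_of_le (fun h0 => hb1 (Subgroup.mem_bot.mp (h0 ▸ hbK))) inf_le_left
  have hlB : l ∈ B := by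
    rw [← hcent, Subgroup.mem_centralizer_iff]
    exact fun x hx => Subgroup.mem_centralizer_singleton_iff.mp (hK.ge hx).2
  exact hl1 (Subgroup.disjoint_def.mp hBL.disjoint hlB hl)

theorem exists_conj_eq_mul [Finite B] [B.Normal] {g x : G}
    (hg : ∀ b ∈ B, Commute g b → b = 1) (hx : x ∈ B) : ∃ y ∈ B, y * g * y⁻¹ = x * g := by
  let f : B → B := fun y => ⟨y * (g * (y : G)⁻¹ * g⁻¹),
    mul_mem y.2 (‹B.Normal›.conj_mem _ (inv_mem y.2) g)⟩
  have hf : Function.Injective f := by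
    intro y z hyz
    have hconj : (y : G) * g * (y : G)⁻¹ = z * g * (z : G)⁻¹ := by
      have := congrArg (· * g) (congrArg Subtype.val hyz)
      simpa [f, mul_assoc] using this
    have hcomm : g * ((z : G)⁻¹ * y) = (z : G)⁻¹ * y * g :=
      calc g * ((z : G)⁻¹ * y) = (z : G)⁻¹ * (z * g * (z : G)⁻¹) * y := by group
        _ = (z : G)⁻¹ * (y * g * (y : G)⁻¹) * y := by rw [hconj]
        _ = (z : G)⁻¹ * y * g := by group
    exact Subtype.ext (inv_mul_eq_one.mp (hg _ (mul_mem (inv_mem z.2) y.2) hcomm)).symm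
  obtain ⟨y, hy⟩ := Finite.surjective_of_injective hf ⟨x, hx⟩
  refine ⟨y, y.2, ?_⟩
  have hyx : (y : G) * (g * (y : G)⁻¹ * g⁻¹) = x := congrArg Subtype.val hy
  rw [← hyx]
  group

/-- `B` and the conjugates of `L` under `B` cover, as the nontrivial elements of `L` act on `B`
without fixed points. -/
theorem coveringNumber_le_card_add_one_of_isComplement' [Finite G] [IsMulCommutative B]
    [IsMulCommutative L] (hL : L ≠ ⊥) (hB : IsMinimalNormal B) (hBL : B.IsComplement' L)
    (hcent : Subgroup.centralizer (B : Set G) = B) : coveringNumber G ≤ Nat.card B + 1 := by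
  have := hB.normal
  have hle := coveringNumber_le_card
    (fun o : Option B => o.elim B fun b => ConjAct.toConjAct (b : G) • L) ?_ ?_
  · rwa [Finite.card_option] at hle
  · rintro (_ | b) htop
    · have h : B = ⊤ := htop
      exact hL (disjoint_top.mp (h ▸ hBL.disjoint.symm))
    · have h : ConjAct.toConjAct (b : G) • L = ⊤ := htop
      have hLtop : L = ⊤ := by
        rw [← inv_smul_smul (ConjAct.toConjAct (b : G)) L, h, Subgroup.Normal.conjAct inferInstance]
      exact hB.ne_bot (disjoint_top.mp (hLtop ▸ hBL.disjoint))
  · intro g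
    obtain ⟨x, hx, l, hl, rfl⟩ := Subgroup.mem_sup_of_normal_left.mp
      (hBL.sup_eq_top.ge (Subgroup.mem_top g))
    by_cases hl1 : l = 1
    · exact ⟨none, by rwa [hl1, mul_one]⟩
    · obtain ⟨y, hy, hyx⟩ := exists_conj_eq_mul
        (fun b => eq_one_of_commute_of_isComplement' hB hBL hcent hl hl1) hx
      exact ⟨some ⟨y, hy⟩, l, hl, hyx⟩

/-- The action of `G ⧸ B` on the abelian normal subgroup `B` by conjugation. -/
def conjQuotient (B : Subgroup G) [B.Normal] [IsMulCommutative B] : G ⧸ B →* MulAut B :=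
  QuotientGroup.lift B MulAut.conjNormal fun b hb => MulEquiv.ext fun x => Subtype.ext <| by
    rw [MulAut.conjNormal_apply, setLike_mul_comm hb x.2,
      mul_inv_cancel_right, MulAut.one_apply]

theorem conjQuotient_injective [B.Normal] [IsMulCommutative B]
    (hcent : Subgroup.centralizer (B : Set G) = B) : Function.Injective (conjQuotient B) := by
  refine (injective_iff_map_eq_one _).mpr fun q hq => ?_
  obtain ⟨g, rfl⟩ := QuotientGroup.mk_surjective q
  rw [QuotientGroup.eq_one_iff, ← hcent, Subgroup.mem_centralizer_iff]
  intro b hb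
  have hgb : g * b * g⁻¹ = b := congrArg Subtype.val (DFunLike.congr_fun hq (⟨b, hb⟩ : B))
  exact (mul_inv_eq_iff_eq_mul.mp hgb).symm

open scoped IsMulCommutative

/-- The representation of `G ⧸ B` over `ZMod p` afforded by the elementary abelian normal
subgroup `B`, written additively. -/
def conjRepresentation (p : ℕ) (B : Subgroup G) [B.Normal] [IsMulCommutative B]
    [Module (ZMod p) (Additive B)] : Representation (ZMod p) (G ⧸ B) (Additive B) where
  toFun q := (MulEquiv.toAdditive (conjQuotient B q)).toAddMonoidHom.toZModLinearMap p
  map_one' := by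
    ext v
    simp
  map_mul' q r := by
    ext v
    simp

variable [B.Normal] [IsMulCommutative B] [Module (ZMod p) (Additive B)]

theorem conjRepresentation_injective (hcent : Subgroup.centralizer (B : Set G) = B) :
    Function.Injective (conjRepresentation p B) := fun _ _ h =>
  conjQuotient_injective hcent <| MulEquiv.ext fun x =>
    congrArg Additive.toMul (LinearMap.congr_fun h (Additive.ofMul x))

theorem isIrreducible_conjRepresentation [Fact p.Prime] (hB : IsMinimalNormal B) :
    (conjRepresentation p B).IsIrreducible where
  exists_pair_ne := by
    have := (Subgroup.nontrivial_iff_ne_bot B).mpr hB.ne_bot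
    obtain ⟨v, hv⟩ := exists_ne (0 : Additive B)
    exact ⟨⊥, ⊤, fun h => hv ((SetLike.ext_iff.mp h v).mpr trivial)⟩
  eq_bot_or_eq_top W := by
    let K : Subgroup B := W.toSubmodule.toAddSubgroup.toSubgroup'
    have hK : (K.map B.subtype).Normal := by
      refine ⟨?_⟩
      rintro _ ⟨x, hx, rfl⟩ g
      exact ⟨conjQuotient B g x, W.apply_mem_toSubmodule g hx, rfl⟩
    have hmem : ∀ x : B, (x : G) ∈ K.map B.subtype ↔ Additive.ofMul x ∈ W.toSubmodule := fun x =>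
      Subgroup.mem_map_iff_mem B.subtype_injective
    refine or_iff_not_imp_left.mpr fun hW => ?_
    have hKB : K.map B.subtype = B := by
      refine hB.eq_of_le (fun h0 => hW ?_) (Subgroup.map_subtype_le K)
      refine Subrepresentation.toSubmodule_injective ((Submodule.eq_bot_iff _).mpr fun v hv => ?_)
      have hv0 := (hmem v.toMul).mpr hv
      rw [h0, Subgroup.mem_bot] at hv0
      exact congrArg Additive.ofMul (Subtype.ext hv0 : v.toMul = 1)
    exact Subrepresentation.toSubmodule_injective ((Submodule.eq_top_iff').mpr fun v =>
      (hmem v.toMul).mp (hKB.ge v.toMul.2))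

end PrimitiveGroups

section CoveringNumberBound

open scoped IsMulCommutative Pointwise

variable {G H : Type*} [Group G] [Group H] {L : Subgroup G}

/-- If the complement `L ≃* G ⧸ B` of the socle `B` is not nilpotent, then it has a non-normal
maximal subgroup of index less than `|B| = L.index`, contrary to the choice of `L`. -/
theorem coveringNumber_le_index_add_one_of_normalCore_eq_bot [Finite G] [Group.IsSolvable G]
    (hL : IsCoatom L) (hLn : ¬ L.Normal) (hcore : L.normalCore = ⊥)
    (hmin : ∀ M : Subgroup G, IsCoatom M → ¬ M.Normal → L.index ≤ M.index) :
    coveringNumber G ≤ L.index + 1 := by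
  have : Nontrivial G := Subgroup.nontrivial_iff.mp ⟨L, ⊤, hL.1⟩
  obtain ⟨B, hB, hBL⟩ := exists_isMinimalNormal_isComplement' hL hcore
  have := hB.normal
  have := hB.isMulCommutative
  have hcent := centralizer_eq_of_isComplement' hBL hcore
  obtain ⟨p, hp, hpow⟩ := hB.exists_forall_pow_prime_eq_one
  have : Fact p.Prime := ⟨hp⟩
  let _ : Module (ZMod p) (Additive B) :=
    AddCommGroup.zmodModule fun v => congrArg Additive.ofMul (hpow v.toMul)
  have hinj := conjRepresentation_injective (p := p) hcent
  have hsurj := QuotientGroup.mk'_surjective B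
  have hcard : Nat.card (Additive B) = L.index := hBL.index_eq_card.symm
  rcases em (Group.IsNilpotent (G ⧸ B)) with hnil | hnil
  · rcases em (IsCyclic (G ⧸ B)) with hcyc | hcyc
    · have : IsCyclic L := hBL.symm.QuotientMulEquiv.isCyclic.mp hcyc
      have hL0 : L ≠ ⊥ := fun h => hLn (h ▸ inferInstance)
      rw [hBL.index_eq_card]
      exact coveringNumber_le_card_add_one_of_isComplement' hL0 hB hBL hcent
    · let _ : MulDistribMulAction (G ⧸ B) B := MulDistribMulAction.compHom B (conjQuotient B)
      have : FaithfulSMul (G ⧸ B) B :=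
        ⟨fun h => conjQuotient_injective hcent (MulEquiv.ext h)⟩
      calc coveringNumber G ≤ coveringNumber (G ⧸ B) := coveringNumber_le_of_surjective hcyc _ hsurj
        _ ≤ Nat.card B := coveringNumber_le_card_of_isNilpotent hnil hcyc
        _ ≤ L.index + 1 := hBL.index_eq_card.ge.trans (Nat.le_succ _)
  · have : Nontrivial (Additive B) := (Subgroup.nontrivial_iff_ne_bot B).mpr hB.ne_bot
    have := isIrreducible_conjRepresentation (p := p) hB
    obtain ⟨M, hM, hMn, hlt⟩ := exists_not_normal_isCoatom_index_lt hinj hnil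
    have hle := hmin _ (Subgroup.isCoatom_comap_of_surjective hsurj hM) fun h =>
      hMn (Subgroup.map_comap_eq_self_of_surjective hsurj M ▸ h.map _ hsurj)
    rw [Subgroup.index_comap_of_surjective _ hsurj, ← hcard] at hle
    exact absurd hlt hle.not_gt

theorem isCoatom_map_of_ker_le {f : G →* H} (hf : Function.Surjective f) (hL : IsCoatom L)
    (hker : f.ker ≤ L) : IsCoatom (L.map f) := by
  have hcm := Subgroup.comap_map_eq_self hker
  refine ⟨fun h => hL.1 ?_, fun K hK => ?_⟩
  · rw [← hcm, h, Subgroup.comap_top]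
  · rw [← Subgroup.map_comap_eq_self_of_surjective hf K, hL.2 (K.comap f) ?_,
      Subgroup.map_top_of_surjective f hf]
    rw [← hcm]
    exact Subgroup.comap_lt_comap_of_surjective hf |>.mpr hK

theorem normal_of_map_normal {f : G →* H} (hker : f.ker ≤ L) (h : (L.map f).Normal) :
    L.Normal :=
  Subgroup.comap_map_eq_self hker ▸ h.comap f

theorem normalCore_map_mk'_normalCore (L : Subgroup G) :
    (L.map (QuotientGroup.mk' L.normalCore)).normalCore = ⊥ := by
  have hker : (QuotientGroup.mk' L.normalCore).ker ≤ L :=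
    (QuotientGroup.ker_mk' _).trans_le L.normalCore_le
  refine eq_bot_iff.mpr fun q hq => ?_
  obtain ⟨g, rfl⟩ := QuotientGroup.mk_surjective q
  have hle : (L.map (QuotientGroup.mk' L.normalCore)).normalCore.comap
      (QuotientGroup.mk' L.normalCore) ≤ L.normalCore := by
    rw [Subgroup.normal_le_normalCore]
    exact (Subgroup.comap_mono (Subgroup.normalCore_le _)).trans_eq
      (Subgroup.comap_map_eq_self hker)
  exact (QuotientGroup.eq_one_iff g).mpr (hle hq)

theorem coveringNumber_le_index_add_one [Finite G] [Group.IsSolvable G] (hL : IsCoatom L)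
    (hLn : ¬ L.Normal) : coveringNumber G ≤ L.index + 1 := by
  obtain ⟨M, ⟨hM, hMn⟩, hmin⟩ := Set.exists_min_image {M : Subgroup G | IsCoatom M ∧ ¬ M.Normal}
    (fun M => M.index) (Set.toFinite _) ⟨L, hL, hLn⟩
  refine le_trans ?_ (Nat.add_le_add_right (hmin L ⟨hL, hLn⟩) 1)
  let π := QuotientGroup.mk' M.normalCore
  have hπ : Function.Surjective π := QuotientGroup.mk'_surjective M.normalCore
  have hker : π.ker ≤ M := (QuotientGroup.ker_mk' _).trans_le M.normalCore_le
  have hMn' : ¬ (M.map π).Normal := fun h => hMn (normal_of_map_normal hker h)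
  have hindex : (M.map π).index = M.index := by
    rw [← Subgroup.index_comap_of_surjective _ hπ, Subgroup.comap_map_eq_self hker]
  have hmin' : ∀ K : Subgroup (G ⧸ M.normalCore), IsCoatom K → ¬ K.Normal →
      (M.map π).index ≤ K.index := fun K hK hKn => by
    rw [hindex, ← Subgroup.index_comap_of_surjective K hπ]
    exact hmin _ ⟨Subgroup.isCoatom_comap_of_surjective hπ hK, fun h =>
      hKn (Subgroup.map_comap_eq_self_of_surjective hπ K ▸ h.map π hπ)⟩
  calc coveringNumber G ≤ coveringNumber (G ⧸ M.normalCore) :=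
        coveringNumber_le_of_surjective (fun _ => hMn' inferInstance) π hπ
    _ ≤ (M.map π).index + 1 := coveringNumber_le_index_add_one_of_normalCore_eq_bot
        (isCoatom_map_of_ker_le hπ hM hker) hMn' (normalCore_map_mk'_normalCore M) hmin'
    _ = M.index + 1 := by rw [hindex]

end CoveringNumberBound

section CountingMaximalSubgroups

open scoped Pointwise

variable {G H : Type*} [Group G] [Group H] {K L M : Subgroup G}

theorem numMaximalSubgroups_eq_ncard (G : Type*) [Group G] :
    numMaximalSubgroups G = {M : Subgroup G | IsCoatom M}.ncard :=
  Nat.card_coe_set_eq _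

theorem numMaximalSubgroups_pos [Finite G] [Nontrivial G] : 0 < numMaximalSubgroups G := by
  obtain ⟨M, hM, -⟩ := (eq_top_or_exists_le_coatom (⊥ : Subgroup G)).resolve_left bot_ne_top
  exact numMaximalSubgroups_eq_ncard G ▸ (Set.ncard_pos (Set.toFinite _)).mpr ⟨M, hM⟩

theorem coveringNumber_le_numMaximalSubgroups [Finite G] (hG : ¬ IsCyclic G) :
    coveringNumber G ≤ numMaximalSubgroups G := by
  refine coveringNumber_le_card (fun M : {M : Subgroup G // IsCoatom M} => M.1)
    (fun M => M.2.1) fun g => ?_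
  have hg : Subgroup.zpowers g ≠ ⊤ := fun h =>
    hG (isCyclic_iff_exists_zpowers_eq_top.mpr ⟨g, h⟩)
  obtain ⟨M, hM, hle⟩ := (eq_top_or_exists_le_coatom _).resolve_left hg
  exact ⟨⟨M, hM⟩, hle (Subgroup.mem_zpowers g)⟩

theorem ncard_isCoatom_ker_le {f : G →* H} (hf : Function.Surjective f) :
    {M : Subgroup G | IsCoatom M ∧ f.ker ≤ M}.ncard = numMaximalSubgroups H := by
  rw [numMaximalSubgroups_eq_ncard, ← Set.ncard_image_of_injective _ (Subgroup.comap_injective hf)]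
  congr 1
  ext M
  constructor
  · rintro ⟨hM, hle⟩
    exact ⟨M.map f, isCoatom_map_of_ker_le hf hM hle, Subgroup.comap_map_eq_self hle⟩
  · rintro ⟨K, hK, rfl⟩
    exact ⟨Subgroup.isCoatom_comap_of_surjective hf hK, MonoidHom.ker_le_comap f K⟩

theorem ncard_normal_isCoatom (G : Type*) [Group G] :
    {M : Subgroup G | IsCoatom M ∧ M.Normal}.ncard = numMaximalSubgroups (Abelianization G) := by
  rw [← ncard_isCoatom_ker_le (f := Abelianization.of) (QuotientGroup.mk'_surjective _),
    Abelianization.ker_of]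
  congr 1
  ext M
  exact and_congr_right fun hM =>
    ⟨fun _ => commutator_le_of_isCoatom hM, Subgroup.Normal.of_commutator_le G⟩

theorem numMaximalSubgroups_eq_add_ncard (G : Type*) [Group G] [Finite G] :
    numMaximalSubgroups G =
      numMaximalSubgroups (Abelianization G) +
        {M : Subgroup G | IsCoatom M ∧ ¬ M.Normal}.ncard := by
  rw [← ncard_normal_isCoatom, numMaximalSubgroups_eq_ncard]
  exact (Set.ncard_inter_add_ncard_sdiff_eq_ncard _ {M : Subgroup G | M.Normal}).symm

theorem le_iff_le_of_mem_orbit [K.Normal] (hM : M ∈ MulAction.orbit (ConjAct G) L) :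
    K ≤ M ↔ K ≤ L := by
  obtain ⟨g, rfl⟩ := hM
  change K ≤ g • L ↔ K ≤ L
  nth_rw 1 [← Subgroup.Normal.conjAct ‹K.Normal› g]
  exact Subgroup.pointwise_smul_le_pointwise_smul_iff

theorem isCoatom_of_mem_orbit (hL : IsCoatom L) (hM : M ∈ MulAction.orbit (ConjAct G) L) :
    IsCoatom M := by
  obtain ⟨g, rfl⟩ := hM
  exact ((MulAut.conj (ConjAct.ofConjAct g)).mapSubgroup.isCoatom_iff L).mpr hL

theorem normal_of_mem_orbit (hM : M ∈ MulAction.orbit (ConjAct G) L) (h : M.Normal) :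
    L.Normal := by
  obtain ⟨g, hg : g • M = L⟩ := MulAction.mem_orbit_symm.mp hM
  exact hg.symm.trans (Subgroup.Normal.conjAct h g) ▸ h

theorem orbit_subset (hL : IsCoatom L) (hLn : ¬ L.Normal) :
    MulAction.orbit (ConjAct G) L ⊆ {M : Subgroup G | IsCoatom M ∧ ¬ M.Normal} := fun _ hM =>
  ⟨isCoatom_of_mem_orbit hL hM, fun h => hLn (normal_of_mem_orbit hM h)⟩

theorem ncard_orbit (hL : IsCoatom L) (hLn : ¬ L.Normal) :
    (MulAction.orbit (ConjAct G) L).ncard = L.index := by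
  have hnorm : Subgroup.normalizer (L : Set G) = L :=
    (hL.le_iff.mp Subgroup.le_normalizer).resolve_left fun h =>
      hLn (Subgroup.normalizer_eq_top_iff.mp h)
  let f : G →* ConjAct G := ConjAct.toConjAct.toMonoidHom
  have hstab : (MulAction.stabilizer (ConjAct G) L).comap f = L := by
    nth_rw 2 [← hnorm]
    ext g
    exact Subgroup.conjAct_pointwise_smul_iff
  rw [← MulAction.index_stabilizer, ← Subgroup.index_comap_of_surjective _ (f := f)
    ConjAct.toConjAct.surjective, hstab]

theorem numMaximalSubgroups_eq_of_forall_mem_orbit [Finite G] (hL : IsCoatom L) (hLn : ¬ L.Normal)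
    (h : ∀ M : Subgroup G, IsCoatom M → ¬ M.Normal → M ∈ MulAction.orbit (ConjAct G) L) :
    numMaximalSubgroups G = numMaximalSubgroups (Abelianization G) + L.index := by
  rw [numMaximalSubgroups_eq_add_ncard, ← ncard_orbit hL hLn,
    (orbit_subset hL hLn).antisymm fun M hM => h M hM.1 hM.2]

theorem isCyclic_abelianization_of_numMaximalSubgroups_lt [Finite G] [Group.IsSolvable G]
    (hm : numMaximalSubgroups G + 1 < 2 * coveringNumber G) (hL : IsCoatom L) (hLn : ¬ L.Normal) :
    IsCyclic (Abelianization G) := by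
  by_contra hcyc
  have hA : coveringNumber G ≤ numMaximalSubgroups (Abelianization G) :=
    (coveringNumber_le_of_surjective hcyc Abelianization.of (QuotientGroup.mk'_surjective _)).trans
      (coveringNumber_le_numMaximalSubgroups hcyc)
  have horbit := Set.ncard_le_ncard (orbit_subset hL hLn)
  rw [ncard_orbit hL hLn] at horbit
  have hindex := coveringNumber_le_index_add_one hL hLn
  have hcount := numMaximalSubgroups_eq_add_ncard G
  omega

theorem mem_orbit_of_numMaximalSubgroups_lt [Finite G] [Group.IsSolvable G]
    (hm : numMaximalSubgroups G + 1 < 2 * coveringNumber G) (hL : IsCoatom L) (hLn : ¬ L.Normal)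
    (hM : IsCoatom M) (hMn : ¬ M.Normal) : M ∈ MulAction.orbit (ConjAct G) L := by
  by_contra hML
  have hdisj : Disjoint (MulAction.orbit (ConjAct G) M) (MulAction.orbit (ConjAct G) L) :=
    (MulAction.orbit.eq_or_disjoint M L).resolve_left fun h => hML (h ▸ MulAction.mem_orbit_self M)
  have horbits := Set.ncard_le_ncard (Set.union_subset (orbit_subset hM hMn) (orbit_subset hL hLn))
  rw [Set.ncard_union_eq hdisj, ncard_orbit hM hMn, ncard_orbit hL hLn] at horbits
  have : Nontrivial G := Subgroup.nontrivial_iff.mp ⟨L, ⊤, hL.1⟩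
  have : Nontrivial (Abelianization G) := QuotientGroup.nontrivial_iff.mpr
    (Group.IsSolvable.commutator_lt_top_of_nontrivial G).ne
  have hpos := numMaximalSubgroups_pos (G := Abelianization G)
  have hindexL := coveringNumber_le_index_add_one hL hLn
  have hindexM := coveringNumber_le_index_add_one hM hMn
  have hcount := numMaximalSubgroups_eq_add_ncard G
  omega

end CountingMaximalSubgroups

section CyclicGroups

theorem isCoatom_of_index_prime {G : Type*} [Group G] {M : Subgroup G} (h : M.index.Prime) :
    IsCoatom M := by
  refine ⟨fun hM => h.ne_one (Subgroup.index_eq_one.mpr hM), fun K hK => ?_⟩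
  have hmul := Subgroup.relIndex_mul_index hK.le
  rcases (Nat.dvd_prime h).mp (Dvd.intro_left _ hmul) with hK1 | hKM
  · exact Subgroup.index_eq_one.mp hK1
  · have hrel := (Nat.mul_eq_right h.ne_zero).mp (hKM ▸ hmul)
    exact absurd (Subgroup.relIndex_eq_one.mp hrel) hK.not_ge

variable {C : Type*} [CommGroup C] [Finite C] [IsCyclic C]

theorem range_powMonoidHom_index (M : Subgroup C) : (powMonoidHom M.index : C →* C).range = M := by
  have hle : (powMonoidHom M.index : C →* C).range ≤ M := by
    rintro _ ⟨c, rfl⟩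
    exact M.pow_index_mem c
  refine hle.antisymm (Subgroup.relIndex_eq_one.mp ?_)
  have hmul := Subgroup.relIndex_mul_index hle
  rw [IsCyclic.index_powMonoidHom_range, Nat.gcd_eq_right M.index_dvd_card] at hmul
  exact (Nat.mul_eq_right Subgroup.index_ne_zero_of_finite).mp hmul

theorem numMaximalSubgroups_of_isCyclic (C : Type*) [CommGroup C] [Finite C] [IsCyclic C] :
    numMaximalSubgroups C = (Nat.card C).primeFactors.card := by
  have hinj : Function.Injective (Subgroup.index : Subgroup C → ℕ) := fun M N h => by
    rw [← range_powMonoidHom_index M, h, range_powMonoidHom_index]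
  rw [numMaximalSubgroups_eq_ncard, ← Set.ncard_coe_finset, ← Set.ncard_image_of_injective _ hinj]
  congr 1
  ext p
  constructor
  · rintro ⟨M, hM, rfl⟩
    exact Nat.mem_primeFactors.mpr
      ⟨index_prime_of_isCoatom hM, M.index_dvd_card, Nat.card_pos.ne'⟩
  · intro hp
    have hindex : (powMonoidHom p : C →* C).range.index = p := by
      rw [IsCyclic.index_powMonoidHom_range, Nat.gcd_eq_right (Nat.dvd_of_mem_primeFactors hp)]
    exact ⟨_, isCoatom_of_index_prime (hindex.symm ▸ Nat.prime_of_mem_primeFactors hp), hindex⟩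

end CyclicGroups

section FrattiniQuotient

theorem mem_frattini {G : Type*} [Group G] {g : G} :
    g ∈ frattini G ↔ ∀ M : Subgroup G, IsCoatom M → g ∈ M := by
  simp only [frattini, Order.radical, Subgroup.mem_iInf, Set.mem_ofPred_eq]

theorem frattini_quotient_frattini (G : Type*) [Group G] : frattini (G ⧸ frattini G) = ⊥ := by
  refine eq_bot_iff.mpr fun z hz => ?_
  obtain ⟨g, rfl⟩ := QuotientGroup.mk'_surjective (frattini G) z
  refine (QuotientGroup.eq_one_iff g).mpr (mem_frattini.mpr fun M hM => ?_)
  have hker : (QuotientGroup.mk' (frattini G)).ker ≤ M :=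
    (QuotientGroup.ker_mk' _).trans_le (frattini_le_coatom hM)
  rw [← Subgroup.comap_map_eq_self hker]
  exact mem_frattini.mp hz _ (isCoatom_map_of_ker_le (QuotientGroup.mk'_surjective _) hM hker)

theorem numMaximalSubgroups_quotient_frattini (G : Type*) [Group G] :
    numMaximalSubgroups (G ⧸ frattini G) = numMaximalSubgroups G := by
  rw [← ncard_isCoatom_ker_le (QuotientGroup.mk'_surjective (frattini G)), QuotientGroup.ker_mk',
    numMaximalSubgroups_eq_ncard]
  congr 1
  ext M
  exact and_iff_left_of_imp frattini_le_coatom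

variable {G : Type*} [Group G] [Finite G]

theorem coveringNumber_quotient_frattini (h : ¬ IsCyclic (G ⧸ frattini G)) :
    coveringNumber (G ⧸ frattini G) = coveringNumber G := by
  have hsurj := QuotientGroup.mk'_surjective (frattini G)
  refine le_antisymm ?_ (coveringNumber_le_of_surjective h _ hsurj)
  obtain ⟨K, hK, hcover⟩ := exists_cover fun _ : IsCyclic G => h (isCyclic_of_surjective _ hsurj)
  choose M hM hle using fun i => (eq_top_or_exists_le_coatom (K i)).resolve_left (hK i)
  refine (coveringNumber_le_card (fun i => (M i).map (QuotientGroup.mk' (frattini G)))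
    (fun i => ?_) fun z => ?_).trans_eq (Nat.card_fin _)
  · exact (isCoatom_map_of_ker_le hsurj (hM i)
      ((QuotientGroup.ker_mk' _).trans_le (frattini_le_coatom (hM i)))).1
  · obtain ⟨g, rfl⟩ := hsurj z
    obtain ⟨i, hi⟩ := hcover g
    exact ⟨i, Subgroup.mem_map_of_mem _ (hle i hi)⟩

theorem exists_isCoatom_not_normal_quotient_frattini (h : ¬ Group.IsNilpotent G) :
    ∃ L : Subgroup (G ⧸ frattini G), IsCoatom L ∧ ¬ L.Normal := by
  obtain ⟨M, hM, hMn⟩ : ∃ M : Subgroup G, IsCoatom M ∧ ¬ M.Normal := by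
    by_contra! hnormal
    exact h ((Group.isNilpotent_of_finite_tfae.out 0 2 rfl rfl).mpr hnormal)
  have hker : (QuotientGroup.mk' (frattini G)).ker ≤ M :=
    (QuotientGroup.ker_mk' _).trans_le (frattini_le_coatom hM)
  exact ⟨_, isCoatom_map_of_ker_le (QuotientGroup.mk'_surjective _) hM hker,
    fun hn => hMn (normal_of_map_normal hker hn)⟩

end FrattiniQuotient

section UniqueNonnormalMaximal

open scoped Pointwise

variable {G : Type*} [Group G] {B K L M N : Subgroup G}

theorem exists_zpowers_sup_commutator_eq_top [IsCyclic (Abelianization G)] :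
    ∃ x : G, Subgroup.zpowers x ⊔ commutator G = ⊤ := by
  obtain ⟨y, hy⟩ := isCyclic_iff_exists_zpowers_eq_top.mp ‹IsCyclic (Abelianization G)›
  obtain ⟨x, rfl⟩ := QuotientGroup.mk'_surjective (commutator G) y
  refine ⟨x, ?_⟩
  rw [← QuotientGroup.ker_mk' (commutator G), ← Subgroup.comap_map_eq, MonoidHom.map_zpowers]
  exact (congrArg (Subgroup.comap (QuotientGroup.mk' (commutator G))) hy).trans
    (Subgroup.comap_top _)

theorem card_lt_card_of_cover {ι : Type*} [Finite ι] {H : ι → Subgroup G} (hB : B ≠ ⊥) (x : G)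
    (hcover : ∀ g, ∃ i, g ∈ H i) (hdisj : ∀ i, ∀ b ∈ B, b * x ∈ H i → Disjoint (H i) B) :
    Nat.card B < Nat.card ι := by
  choose i hi using fun b : B => hcover (b * x)
  have hinj : Function.Injective i := fun a b hab => by
    have hmem : (a : G) * (b : G)⁻¹ ∈ H (i b) := by
      have := mul_mem (hab ▸ hi a) (inv_mem (hi b))
      rwa [mul_inv_rev, mul_assoc, mul_inv_cancel_left] at this
    have hab1 := Subgroup.disjoint_def.mp (hdisj _ b b.2 (hi b)) hmem (mul_mem a.2 (inv_mem b.2))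
    exact Subtype.ext (mul_inv_eq_one.mp hab1)
  obtain ⟨b₀, hb₀, hb₀1⟩ := (Subgroup.bot_or_exists_ne_one B).resolve_left hB
  obtain ⟨i₀, hi₀⟩ := hcover b₀
  have hi₀_range : i₀ ∉ Set.range i := by
    rintro ⟨b, rfl⟩
    exact hb₀1 (Subgroup.disjoint_def.mp (hdisj _ b b.2 (hi b)) hi₀ hb₀)
  rw [← Nat.card_range_of_injective hinj, Nat.card_coe_set_eq]
  exact Set.ncard_lt_card fun h => hi₀_range (h ▸ Set.mem_univ i₀)

theorem exists_pow_eq_of_pow_eq_one {C : Type*} [Group C] [IsCyclic C] {n : ℕ} (hn : n ≠ 0)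
    (hC : n * n ∣ Nat.card C) {z : C} (hz : z ^ n = 1) : ∃ w, w ^ n = z := by
  obtain ⟨y, hy⟩ := IsCyclic.exists_generator (α := C)
  obtain ⟨k, rfl⟩ := hy z
  have hk : (n * n : ℤ) ∣ k * n := by
    rw [← zpow_natCast, ← zpow_mul, ← orderOf_dvd_iff_zpow_eq_one,
      orderOf_eq_card_of_forall_mem_zpowers hy] at hz
    exact (Int.natCast_dvd_natCast.mpr hC).trans hz
  obtain ⟨j, rfl⟩ := Int.dvd_of_mul_dvd_mul_right (Int.natCast_ne_zero.mpr hn) hk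
  exact ⟨y ^ j, by rw [← zpow_natCast, ← zpow_mul, mul_comm]⟩

theorem pow_mem_of_isCoatom [M.Normal] (hM : IsCoatom M) {p : ℕ} (hp : p.Prime)
    {w : G} (hw : (w ^ p) ^ p = 1) : w ^ p ∈ M := by
  by_cases hMp : M.index = p
  · exact hMp ▸ M.pow_index_mem w
  · have hcop : M.index.Coprime p := (Nat.coprime_primes (index_prime_of_isCoatom hM) hp).mpr hMp
    have hmem : w ^ p ∈ Subgroup.zpowers ((w ^ p) ^ M.index) :=
      mem_zpowers_pow_iff.mpr (hcop.coprime_dvd_right (orderOf_dvd_of_pow_eq_one hw))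
    exact Subgroup.zpowers_le.mpr (M.pow_index_mem _) hmem

/-- `L` is up to conjugacy the only non-normal maximal subgroup of a group with cyclic
abelianization and trivial Frattini subgroup. For finite soluble groups this is what the hypothesis
`m(G) < 2σ - 1` leaves after passing to the quotient by the Frattini subgroup. -/
structure IsUniqueNonnormalMaximal (L : Subgroup G) : Prop where
  isCoatom : IsCoatom L
  not_normal : ¬ L.Normal
  mem_orbit : ∀ M : Subgroup G, IsCoatom M → ¬ M.Normal → M ∈ MulAction.orbit (ConjAct G) L
  isCyclic_abelianization : IsCyclic (Abelianization G)
  frattini_eq_bot : frattini G = ⊥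

namespace IsUniqueNonnormalMaximal

theorem of_numMaximalSubgroups_lt [Finite G] [Group.IsSolvable G] (hG : frattini G = ⊥)
    (hm : numMaximalSubgroups G + 1 < 2 * coveringNumber G) (hL : IsCoatom L) (hLn : ¬ L.Normal) :
    IsUniqueNonnormalMaximal L where
  isCoatom := hL
  not_normal := hLn
  mem_orbit _ hM hMn := mem_orbit_of_numMaximalSubgroups_lt hm hL hLn hM hMn
  isCyclic_abelianization := isCyclic_abelianization_of_numMaximalSubgroups_lt hm hL hLn
  frattini_eq_bot := hG

theorem commutator_le [Finite G] [K.Normal] (h : IsUniqueNonnormalMaximal L) (hKL : ¬ K ≤ L) :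
    commutator G ≤ K := by
  have := h.isCyclic_abelianization
  obtain ⟨x, hx⟩ := exists_zpowers_sup_commutator_eq_top (G := G)
  refine Subgroup.Normal.commutator_le_of_self_sup_commutative_eq_top (H := Subgroup.zpowers x)
    ?_ inferInstance
  by_contra hKx
  obtain ⟨M, hM, hle⟩ := (eq_top_or_exists_le_coatom _).resolve_left hKx
  by_cases hMn : M.Normal
  · exact hM.1 (top_le_iff.mp (hx.symm.trans_le
      (sup_le (le_sup_right.trans hle) (commutator_le_of_isCoatom hM))))
  · exact hKL ((le_iff_le_of_mem_orbit (h.mem_orbit M hM hMn)).mp (le_sup_left.trans hle))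

theorem not_commutator_le (h : IsUniqueNonnormalMaximal L) : ¬ commutator G ≤ L := fun hle =>
  h.not_normal (Subgroup.Normal.of_commutator_le G hle)

theorem commutator_ne_bot (h : IsUniqueNonnormalMaximal L) : commutator G ≠ ⊥ := fun h0 =>
  h.not_commutator_le (h0 ▸ bot_le)

theorem eq_one_of_mem_normalCore (h : IsUniqueNonnormalMaximal L) {z : G} (hz : z ∈ L.normalCore)
    (hzM : ∀ M : Subgroup G, IsCoatom M → M.Normal → z ∈ M) : z = 1 := by
  rw [← Subgroup.mem_bot, ← h.frattini_eq_bot, mem_frattini]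
  intro M hM
  by_cases hMn : M.Normal
  · exact hzM M hM hMn
  · exact (le_iff_le_of_mem_orbit (h.mem_orbit M hM hMn)).mpr L.normalCore_le hz

theorem disjoint_normalCore_commutator (h : IsUniqueNonnormalMaximal L) :
    Disjoint L.normalCore (commutator G) :=
  Subgroup.disjoint_def.mpr fun hz hzG => h.eq_one_of_mem_normalCore hz fun _ hM _ =>
    commutator_le_of_isCoatom hM hzG

theorem normalCore_le_center (h : IsUniqueNonnormalMaximal L) :
    L.normalCore ≤ Subgroup.center G := by
  rw [← Subgroup.centralizer_univ, ← Subgroup.coe_top,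
    ← Subgroup.commutator_eq_bot_iff_le_centralizer]
  exact le_bot_iff.mp (h.disjoint_normalCore_commutator (Subgroup.commutator_le_left _ _)
    (Subgroup.commutator_mono le_top le_rfl))

theorem isMinimalNormal_commutator [Finite G] (h : IsUniqueNonnormalMaximal L) :
    IsMinimalNormal (commutator G) := by
  refine ⟨⟨inferInstance, h.commutator_ne_bot⟩,
    fun K ⟨hKn, hK0⟩ hK => h.commutator_le fun hKL => ?_⟩
  exact hK0 (le_bot_iff.mp
    (h.disjoint_normalCore_commutator (Subgroup.normal_le_normalCore.mpr hKL) hK))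

variable [Finite G] [Group.IsSolvable G]

theorem isComplement'_commutator (h : IsUniqueNonnormalMaximal L) :
    (commutator G).IsComplement' L :=
  h.isMinimalNormal_commutator.isComplement'_of_not_le h.isCoatom h.not_commutator_le

theorem isCyclic (h : IsUniqueNonnormalMaximal L) : IsCyclic L :=
  h.isComplement'_commutator.symm.QuotientMulEquiv.isCyclic.mp h.isCyclic_abelianization

theorem card_abelianization (h : IsUniqueNonnormalMaximal L) :
    Nat.card (Abelianization G) = Nat.card L :=
  Nat.card_congr h.isComplement'_commutator.symm.QuotientMulEquiv.toEquiv

theorem disjoint_commutator_of_mul_mem (h : IsUniqueNonnormalMaximal L) {x b : G}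
    (hx : Subgroup.zpowers x ⊔ commutator G = ⊤) (hK : K ≠ ⊤) (hb : b ∈ commutator G)
    (hbx : b * x ∈ K) : Disjoint K (commutator G) := by
  obtain ⟨M, hM, hKM⟩ := (eq_top_or_exists_le_coatom K).resolve_left hK
  have hGM : ¬ commutator G ≤ M := fun hle => by
    have hxM : x ∈ M := (Subgroup.mul_mem_cancel_left M (hle hb)).mp (hKM hbx)
    exact hM.1 (top_le_iff.mp (hx.symm.trans_le (sup_le (Subgroup.zpowers_le.mpr hxM) hle)))
  exact (h.isMinimalNormal_commutator.isComplement'_of_not_le hM hGM).disjoint.symm.mono_left hKM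

theorem coveringNumber_eq (h : IsUniqueNonnormalMaximal L) :
    coveringNumber G = L.index + 1 := by
  have := h.isCyclic_abelianization
  refine (coveringNumber_le_index_add_one h.isCoatom h.not_normal).antisymm ?_
  obtain ⟨x, hx⟩ := exists_zpowers_sup_commutator_eq_top (G := G)
  obtain ⟨K, hK, hcover⟩ := exists_cover fun _ : IsCyclic G => h.not_normal inferInstance
  have hlt := card_lt_card_of_cover h.commutator_ne_bot x hcover fun i _ =>
    h.disjoint_commutator_of_mul_mem hx (hK i)
  rwa [Nat.card_fin, ← h.isComplement'_commutator.index_eq_card] at hlt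

theorem numMaximalSubgroups_eq (h : IsUniqueNonnormalMaximal L) :
    numMaximalSubgroups G = (Nat.card L).primeFactors.card + L.index := by
  have := h.isCyclic_abelianization
  rw [numMaximalSubgroups_eq_of_forall_mem_orbit h.isCoatom h.not_normal h.mem_orbit,
    numMaximalSubgroups_of_isCyclic, h.card_abelianization]

theorem coveringNumber_ne_three (h : IsUniqueNonnormalMaximal L) : coveringNumber G ≠ 3 := by
  rw [h.coveringNumber_eq]
  exact fun h3 => h.not_normal (Subgroup.normal_of_index_eq_two (by omega))

theorem not_mul_self_dvd_card (h : IsUniqueNonnormalMaximal L) {p : ℕ} (hp : p.Prime)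
    (hdvd : p ∣ Nat.card L.normalCore) : ¬ p * p ∣ Nat.card L := by
  intro hpp
  have := h.isCyclic
  have : Fact p.Prime := ⟨hp⟩
  obtain ⟨z, hz⟩ := exists_prime_orderOf_dvd_card' p hdvd
  have hzp : (z : G) ^ p = 1 := congrArg Subtype.val (hz ▸ pow_orderOf_eq_one z)
  obtain ⟨w, hw⟩ := exists_pow_eq_of_pow_eq_one hp.ne_zero hpp
    (z := ⟨z, L.normalCore_le z.2⟩) (Subtype.ext hzp)
  have hw : (w : G) ^ p = z := congrArg Subtype.val hw
  have hz1 : (z : G) = 1 := h.eq_one_of_mem_normalCore z.2 fun M hM _ =>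
    hw ▸ pow_mem_of_isCoatom hM hp (hw.symm ▸ hzp)
  rw [OneMemClass.coe_eq_one.mp hz1, orderOf_one] at hz
  exact hp.ne_one hz.symm

end IsUniqueNonnormalMaximal

end UniqueNonnormalMaximal

section InternalDecomposition

variable {G : Type*} [Group G] {E L : Subgroup G} {T N : Subgroup L}

theorem exists_mulEquiv_semidirectProduct_prod [E.Normal] (hEL : E.IsComplement' L)
    (hTN : T.IsComplement' N) (hN : N.map L.subtype ≤ Subgroup.center G) :
    Nonempty (G ≃*
      (E ⋊[(MulAut.conjNormal : G →* MulAut E).comp (L.subtype.comp T.subtype)] T) × N) := by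
  let f : (E ⋊[(MulAut.conjNormal : G →* MulAut E).comp (L.subtype.comp T.subtype)] T) →* G :=
    SemidirectProduct.lift E.subtype (L.subtype.comp T.subtype) fun t => MonoidHom.ext fun e =>
      MulAut.conjNormal_apply _ e
  let F := MonoidHom.noncommCoprod f (L.subtype.comp N.subtype) fun y n =>
    (Subgroup.mem_center_iff.mp (hN (Subgroup.mem_map_of_mem L.subtype n.2)) (f y))
  have hF : ∀ (e : E) (t : T) (n : N), F (⟨e, t⟩, n) = e * ((t * n : L) : G) := fun e t n =>
    mul_assoc _ _ _
  refine ⟨(MulEquiv.ofBijective F ⟨?_, fun g => ?_⟩).symm⟩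
  · refine (injective_iff_map_eq_one F).mpr ?_
    rintro ⟨⟨e, t⟩, n⟩ h1
    rw [hF] at h1
    obtain ⟨he, htn⟩ := Subgroup.disjoint_iff_mul_eq_one.mp hEL.disjoint e.2 (t * n : L).2 h1
    obtain ⟨ht, hn⟩ := Subgroup.disjoint_iff_mul_eq_one.mp hTN.disjoint t.2 n.2 (Subtype.ext htn)
    rw [OneMemClass.coe_eq_one.mp he, OneMemClass.coe_eq_one.mp ht, OneMemClass.coe_eq_one.mp hn]
    rfl
  · obtain ⟨⟨e, l⟩, rfl⟩ := hEL.2 g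
    obtain ⟨⟨t, n⟩, rfl⟩ := hTN.2 l
    exact ⟨(⟨e, t⟩, n), hF e t n⟩

theorem card_dvd_card_mulAut_of_disjoint [E.Normal] (hEL : E.IsComplement' L)
    (hT : Disjoint T (L.normalCore.subgroupOf L)) : Nat.card T ∣ Nat.card (MulAut E) := by
  refine Subgroup.card_dvd_of_injective
    ((MulAut.conjNormal : G →* MulAut E).comp (L.subtype.comp T.subtype))
    ((injective_iff_map_eq_one _).mpr fun t ht => ?_)
  have hcent : ((t : L) : G) ∈ Subgroup.centralizer (E : Set G) := by
    refine Subgroup.mem_centralizer_iff.mpr fun e he => ?_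
    have hte : ((t : L) : G) * e * ((t : L) : G)⁻¹ = e :=
      congrArg Subtype.val (DFunLike.congr_fun ht (⟨e, he⟩ : E))
    exact (mul_inv_eq_iff_eq_mul.mp hte).symm
  have hcore := inf_centralizer_le_normalCore hEL.sup_eq_top ⟨(t : L).2, hcent⟩
  exact Subtype.ext (Subgroup.disjoint_def.mp hT t.2 hcore)

end InternalDecomposition

section CyclicGroupZ

theorem numMaximalSubgroups_cyclicGroupZ {t : ℕ} (ht : t ≠ 0) :
    numMaximalSubgroups (CyclicGroupZ t) = t.primeFactors.card := by
  have : NeZero t := ⟨ht⟩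
  have hcard : Nat.card (CyclicGroupZ t) = t := Nat.card_zmod t
  have : Finite (CyclicGroupZ t) := inferInstanceAs (Finite (ZMod t))
  rw [numMaximalSubgroups_of_isCyclic, hcard]

theorem card_elementaryAbelian (q k : ℕ) : Nat.card (ElementaryAbelian q k) = q ^ k := by
  have hcard : Nat.card (Fin k → ZMod q) = q ^ k := by
    rw [Nat.card_fun, Nat.card_fin, Nat.card_zmod]
  exact hcard

theorem exists_addEquiv_of_finite_module_zmod (q : ℕ) [Fact q.Prime] (V : Type*)
    [AddCommGroup V] [Module (ZMod q) V] [Finite V] :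
    ∃ k : ℕ, Nonempty ((Fin k → ZMod q) ≃+ V) :=
  ⟨_, ⟨(Module.finBasis (ZMod q) V).equivFun.symm.toAddEquiv⟩⟩

theorem exists_elementaryAbelian_mulEquiv {q : ℕ} [Fact q.Prime] {B : Type*} [CommGroup B]
    [Finite B] (hpow : ∀ x : B, x ^ q = 1) : ∃ k : ℕ, Nonempty (ElementaryAbelian q k ≃* B) := by
  let _ : Module (ZMod q) (Additive B) :=
    AddCommGroup.zmodModule fun v => congrArg Additive.ofMul (hpow v.toMul)
  obtain ⟨k, ⟨e⟩⟩ := exists_addEquiv_of_finite_module_zmod q (Additive B)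
  exact ⟨k, ⟨AddEquiv.toMultiplicativeLeft e⟩⟩

open scoped IsMulCommutative in
theorem IsMinimalNormal.exists_mulEquiv_elementaryAbelian {G : Type*} [Group G] [Finite G]
    [Group.IsSolvable G] {B : Subgroup G} (hB : IsMinimalNormal B) :
    ∃ q k : ℕ, q.Prime ∧ 0 < k ∧ Nonempty (ElementaryAbelian q k ≃* B) := by
  have := hB.isMulCommutative
  obtain ⟨q, hq, hpow⟩ := hB.exists_forall_pow_prime_eq_one
  have : Fact q.Prime := ⟨hq⟩
  obtain ⟨k, ⟨e⟩⟩ := exists_elementaryAbelian_mulEquiv hpow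
  refine ⟨q, k, hq, Nat.pos_of_ne_zero fun hk => hB.ne_bot ?_, ⟨e⟩⟩
  rw [← Subgroup.card_eq_one, ← Nat.card_congr e.toEquiv, card_elementaryAbelian, hk, pow_zero]

theorem exists_prime_prod_eq_of_squarefree {n : ℕ} (hn : Squarefree n) :
    ∃ (ℓ : ℕ) (p : Fin ℓ → ℕ), (∀ i, (p i).Prime) ∧ Function.Injective p ∧ ∏ i, p i = n ∧
      n.primeFactors.card = ℓ := by
  refine ⟨_, fun i => n.primeFactors.equivFin.symm i,
    fun i => Nat.prime_of_mem_primeFactors (Subtype.prop _),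
    Subtype.val_injective.comp (Equiv.injective _), ?_, rfl⟩
  rw [Equiv.prod_comp n.primeFactors.equivFin.symm (fun p => (p : ℕ)),
    Finset.prod_coe_sort n.primeFactors (fun p => p), Nat.prod_primeFactors_of_squarefree hn]

end CyclicGroupZ

namespace IsUniqueNonnormalMaximal

variable {G : Type*} [Group G] [Finite G] [Group.IsSolvable G] {L : Subgroup G}

theorem squarefree_card_normalCore (h : IsUniqueNonnormalMaximal L) :
    Squarefree (Nat.card L.normalCore) :=
  Nat.squarefree_iff_prime_squarefree.mpr fun p hp hpp =>
    h.not_mul_self_dvd_card hp ((dvd_mul_right p p).trans hpp)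
      (hpp.trans (Subgroup.card_dvd_of_le L.normalCore_le))

theorem coprime_card_normalCore_relIndex (h : IsUniqueNonnormalMaximal L) :
    (Nat.card L.normalCore).Coprime (L.normalCore.relIndex L) :=
  Nat.coprime_of_dvd fun p hp hpn hpt => h.not_mul_self_dvd_card hp hpn <| by
    have hcard := Subgroup.relIndex_mul_relIndex ⊥ L.normalCore L bot_le L.normalCore_le
    rw [Subgroup.relIndex_bot_left, Subgroup.relIndex_bot_left] at hcard
    exact hcard ▸ mul_dvd_mul hpn hpt

theorem exists_mulEquiv (h : IsUniqueNonnormalMaximal L) :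
    ∃ (t n : ℕ) (φ : CyclicGroupZ t →* MulAut (commutator G)),
      t * n = Nat.card L ∧ t.Coprime n ∧ Squarefree n ∧ t ∣ Nat.card (MulAut (commutator G)) ∧
      Nonempty (G ≃* (commutator G ⋊[φ] CyclicGroupZ t) × CyclicGroupZ n) := by
  have hEL := h.isComplement'_commutator
  have := h.isCyclic
  let N := L.normalCore.subgroupOf L
  have hNcard : Nat.card N = Nat.card L.normalCore :=
    Nat.card_congr (Subgroup.subgroupOfEquivOfLe L.normalCore_le).toEquiv
  obtain ⟨T, hTN⟩ := Subgroup.exists_left_complement'_of_coprime (N := N)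
    (hNcard ▸ h.coprime_card_normalCore_relIndex)
  have hTcard : Nat.card T = L.normalCore.relIndex L := hTN.index_eq_card.symm
  have hN : N.map L.subtype ≤ Subgroup.center G :=
    (Subgroup.map_subgroupOf_eq_of_le L.normalCore_le).trans_le h.normalCore_le_center
  obtain ⟨e⟩ := exists_mulEquiv_semidirectProduct_prod hEL hTN hN
  let eT := zmodCyclicMulEquiv (inferInstance : IsCyclic T)
  let eN := zmodCyclicMulEquiv (inferInstance : IsCyclic N)
  refine ⟨Nat.card T, Nat.card N, _, hTN.card_mul_card, ?_, hNcard ▸ h.squarefree_card_normalCore,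
    card_dvd_card_mulAut_of_disjoint hEL hTN.disjoint,
    ⟨e.trans ((SemidirectProduct.congr' (MulEquiv.refl _) eT.symm).prodCongr eN.symm)⟩⟩
  rw [hNcard, hTcard]
  exact h.coprime_card_normalCore_relIndex.symm

theorem exists_mulEquiv_elementaryAbelian (h : IsUniqueNonnormalMaximal L) :
    ∃ q k : ℕ, q.Prime ∧ 0 < k ∧ q ^ k = L.index ∧
    ∃ (t : ℕ) (φ : CyclicGroupZ t →* MulAut (ElementaryAbelian q k)) (ℓ : ℕ) (p : Fin ℓ → ℕ),
      t ∣ Nat.card (MulAut (ElementaryAbelian q k)) ∧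
      (∀ i, (p i).Prime) ∧ Function.Injective p ∧ (∀ i, (p i).Coprime t) ∧
      (Nat.card L).primeFactors.card = ℓ + numMaximalSubgroups (CyclicGroupZ t) ∧
      Nonempty (G ≃* (ElementaryAbelian q k ⋊[φ] CyclicGroupZ t) × CyclicGroupZ (∏ i, p i)) := by
  obtain ⟨q, k, hq, hk, ⟨eB⟩⟩ := h.isMinimalNormal_commutator.exists_mulEquiv_elementaryAbelian
  obtain ⟨t, n, φ, hcard, hcop, hn, hdvd, ⟨e⟩⟩ := h.exists_mulEquiv
  obtain ⟨ℓ, p, hp, hpinj, rfl, hℓ⟩ := exists_prime_prod_eq_of_squarefree hn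
  have ht : t ≠ 0 := left_ne_zero_of_mul (hcard.trans_ne Nat.card_pos.ne')
  have hcount := congrArg Finset.card (hcop.primeFactors_mul)
  rw [hcard, Finset.card_union_of_disjoint hcop.disjoint_primeFactors, hℓ, add_comm,
    ← numMaximalSubgroups_cyclicGroupZ ht] at hcount
  refine ⟨q, k, hq, hk, ?_, t, _, ℓ, p, ?_, hp, hpinj, fun i => ?_, hcount,
    ⟨e.trans ((SemidirectProduct.congr' eB.symm (MulEquiv.refl _)).prodCongr (MulEquiv.refl _))⟩⟩
  · rw [h.isComplement'_commutator.index_eq_card, ← Nat.card_congr eB.toEquiv,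
      card_elementaryAbelian]
  · rwa [Nat.card_congr (MulAut.congr eB).toEquiv]
  · exact (hcop.coprime_dvd_right (Finset.dvd_prod_of_mem p (Finset.mem_univ i))).symm

end IsUniqueNonnormalMaximal

theorem corollary3p4 (G : Type*) [Group G] [Finite G] (hsol : Group.IsSolvable G)
    (hnil : ¬ Group.IsNilpotent G)
    (hm : (numMaximalSubgroups G : ℤ) < 2 * (coveringNumber G : ℤ) - 1) :
    coveringNumber G ≠ 3 ∧
    ∃ (q k : ℕ), q.Prime ∧ 0 < k ∧ (q : ℤ) ^ k = (coveringNumber G : ℤ) - 1 ∧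
    ∃ (t : ℕ) (φ : CyclicGroupZ t →* MulAut (ElementaryAbelian q k)) (ℓ : ℕ) (p : Fin ℓ → ℕ),
      t ∣ Nat.card (MulAut (ElementaryAbelian q k)) ∧
      (∀ i, (p i).Prime) ∧ Function.Injective p ∧ (∀ i, (p i).Coprime t) ∧
      (ℓ : ℤ) = (numMaximalSubgroups G : ℤ) - (numMaximalSubgroups (CyclicGroupZ t) : ℤ)
        - (coveringNumber G : ℤ) + 1 ∧
      Nonempty ((G ⧸ frattini G) ≃*
        (ElementaryAbelian q k ⋊[φ] CyclicGroupZ t) × CyclicGroupZ (∏ i, p i)) := by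
  obtain ⟨L, hL, hLn⟩ := exists_isCoatom_not_normal_quotient_frattini hnil
  have hcyc : ¬ IsCyclic (G ⧸ frattini G) := fun _ => hLn inferInstance
  rw [← numMaximalSubgroups_quotient_frattini, ← coveringNumber_quotient_frattini hcyc] at hm ⊢
  have hunique : IsUniqueNonnormalMaximal L :=
    .of_numMaximalSubgroups_lt (frattini_quotient_frattini G) (by omega) hL hLn
  have hσ := hunique.coveringNumber_eq
  have hmax := hunique.numMaximalSubgroups_eq
  obtain ⟨q, k, hq, hk, hqk, t, φ, ℓ, p, ht, hp, hpinj, hpt, hℓ, hiso⟩ :=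
    hunique.exists_mulEquiv_elementaryAbelian
  have hqσ : (q : ℤ) ^ k = (coveringNumber (G ⧸ frattini G) : ℤ) - 1 := by
    rw [hσ, ← hqk]
    push_cast
    ring
  exact ⟨hunique.coveringNumber_ne_three, q, k, hq, hk, hqσ, t, φ, ℓ, p, ht, hp, hpinj, hpt,
    by omega, hiso⟩
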